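/- Let $N$ be a nonzero integer and $\Gamma=(2\pi\mathbb Z)^2$. For a unitary character $\Lambda:\Gamma\to U(1)$ let $\mathscr H^\Lambda$ be the Hilbert space of (classes modulo equality almost everywhere of) measurable functions $\varphi:\mathbb R^2\to\mathbb C$ that are square integrable over $D=(0,2\pi)^2$ and satisfy, for all $m,n\in\mathbb Z$, $$\varphi(x+2\pi m,\,y+2\pi n)=\Lambda(2\pi m,2\pi n)\,e^{-imNy}\,\varphi(x,y)\quad\text{for almost every }(x,y)\in\mathbb R^2,$$ with scalar product $\langle\varphi,\psi\rangle=\int_D\overline{\varphi}\,\psi\,dx\,dy$. Let $H^\Lambda$ be the Friedrichs extension in $\mathscr H^\Lambda$ of the operator $$-\partial_x^2-\Bigl(\partial_y+\frac{iN}{2\pi}x\Bigr)^2$$ defined on the $C^\infty$ functions belonging to $\mathscr H^\Lambda$ (the Hamiltonian on the flat torus $(\mathbb R/2\pi\mathbb Z)^2$ with a constant magnetic field of flux $N$, twisted by $\Lambda$). Then: 1. For every $\Lambda$, $$\operatorname{spec}H^\Lambda=\Bigl\{\frac{|N|}{\pi}\Bigl(\ell+\frac12\Bigr):\ \ell=0,1,2,\dots\Bigr\},$$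 and every point of the spectrum is an eigenvalue of multiplicity $|N|$. 2. The operators $H^\Lambda$ are mutually unitarily equivalent: for any two characters $\Lambda_1,\Lambda_2$ there is a unitary map $U:\mathscr H^{\Lambda_1}\to\mathscr H^{\Lambda_2}$ with $H^{\Lambda_2}=UH^{\Lambda_1}U^{-1}$ (equality of unbounded operators, including domains). 3. If $\Lambda(2\pi m,2\pi n)=e^{2\pi i(\mu m+\nu n)}$ for all $m,n\in\mathbb Z$, with $\mu,\nu\in[0,1)$, then the formula $$T^\Lambda\varphi(x,y)=e^{i\nu y}\,\varphi\Bigl(x+\frac{2\pi\nu}{N},\,y-\frac{2\pi\mu}{N}\Bigr)$$ gives a well-defined unitary map $T^\Lambda:\mathscr H^{1}\to\mathscr H^\Lambda$, where $1$ is the trivial character, and $H^\Lambda=T^\Lambda H^{1}(T^\Lambda)^{-1}$. -/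

import Mathlib

open MeasureTheory Set Filter Topology
open scoped ContDiff ComplexConjugate

noncomputable section

namespace MagneticTorus

/-! ### Unbounded operators in a complex Hilbert space -/

section Operators

variable {E F : Type*} [NormedAddCommGroup E] [InnerProductSpace ℂ E]
  [NormedAddCommGroup F] [InnerProductSpace ℂ F]

/-- The form domain of the operator `A`: the vectors `ψ` that are limits of sequences `u n` in the
domain of `A` for which the quadratic form satisfies `⟪u n - u m, A (u n - u m)⟫ → 0` as
`n, m → ∞`, i.e. the domain of the closure of the quadratic form of `A`. If `A` is symmetric and
semibounded, then these vectors already form a subspace, and taking the span changes nothing. -/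
def formDomain (A : E →ₗ.[ℂ] E) : Submodule ℂ E :=
  Submodule.span ℂ {ψ : E | ∃ u : ℕ → A.domain,
    Tendsto (fun n => (u n : E)) atTop (𝓝 ψ) ∧
    Tendsto (fun p : ℕ × ℕ => inner ℂ ((u p.1 - u p.2 : A.domain) : E) (A (u p.1 - u p.2)))
      atTop (𝓝 0)}

/-- The Friedrichs extension of a (densely defined, symmetric, semibounded) operator `A`: the
restriction of the adjoint `A†` to those elements of its domain that lie in the form domain. -/
def friedrichs [CompleteSpace E] (A : E →ₗ.[ℂ] E) : E →ₗ.[ℂ] E :=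
  A.adjoint.domRestrict (formDomain A)

/-- The resolvent set of an unbounded operator `H`: the `z` for which `H - z`, as a map from the
domain of `H` to the whole space, has a bounded everywhere defined two-sided inverse `R`. -/
def resolventSet (H : E →ₗ.[ℂ] E) : Set ℂ :=
  {z | ∃ R : E →L[ℂ] E,
    (∀ χ : E, ∃ h : R χ ∈ H.domain, H ⟨R χ, h⟩ - z • R χ = χ) ∧
    ∀ φ : H.domain, R (H φ - z • (φ : E)) = φ}

/-- The spectrum of an unbounded operator. -/
def spec (H : E →ₗ.[ℂ] E) : Set ℂ := (resolventSet H)ᶜ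

/-- The eigenspace `{φ ∈ Dom H : H φ = z φ}`. -/
def eigenspace (H : E →ₗ.[ℂ] E) (z : ℂ) : Submodule ℂ E :=
  (LinearMap.ker (H.toFun - z • H.domain.subtype)).map H.domain.subtype

/-- The operator `U A U⁻¹`, with domain `U (Dom A)`, for a unitary map `U`. -/
def conjugate (U : E ≃ₗᵢ[ℂ] F) (A : E →ₗ.[ℂ] E) : F →ₗ.[ℂ] F where
  domain := A.domain.comap (U.symm.toLinearEquiv : F →ₗ[ℂ] E)
  toFun := (U.toLinearEquiv : E →ₗ[ℂ] F) ∘ₗ A.toFun ∘ₗ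
    (U.symm.toLinearEquiv : F →ₗ[ℂ] E).submoduleComap A.domain

end Operators

/-! ### Equivariant functions -/

/-- The action of `(2πm, 2πn) ∈ Γ = (2πℤ)²` on `ℝ²`. -/
def shift (m n : ℤ) (p : ℝ × ℝ) : ℝ × ℝ :=
  (p.1 + 2 * Real.pi * m, p.2 + 2 * Real.pi * n)

/-- The factor `Λ(γ) Ψ_γ(x, y)`, with `Ψ_γ(x, y) = exp(-i m N y)`, for `γ = (2πm, 2πn)`. The
unitary character `Λ` of `Γ = (2πℤ)²` is written as a function of `(m, n) ∈ ℤ²`. -/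
def factor (N : ℤ) (Λ : AddChar (ℤ × ℤ) Circle) (m n : ℤ) (p : ℝ × ℝ) : ℂ :=
  (Λ (m, n) : ℂ) * Complex.exp (-(Complex.I * m * N * p.2))

/-- The fundamental domain `D = (0, 2π)²`. -/
def cell : Set (ℝ × ℝ) := Ioo 0 (2 * Real.pi) ×ˢ Ioo 0 (2 * Real.pi)

lemma measurePreserving_shift (m n : ℤ) :
    MeasurePreserving (shift m n) (volume : Measure (ℝ × ℝ)) volume := by
  have := measurePreserving_add_right (volume : Measure (ℝ × ℝ))
    (2 * Real.pi * m, 2 * Real.pi * n)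
  exact this

/-- The space of (classes modulo equality almost everywhere of) measurable functions `φ` on `ℝ²`
which are square integrable over `D` and satisfy, almost everywhere,
`φ(x + 2πm, y + 2πn) = Λ(m, n) exp(-i m N y) φ(x, y)` for all integers `m`, `n`. -/
def equivariant (N : ℤ) (Λ : AddChar (ℤ × ℤ) Circle) :
    Submodule ℂ ((ℝ × ℝ) →ₘ[volume] ℂ) where
  carrier := {φ | MemLp φ 2 (volume.restrict cell) ∧
    ∀ m n : ℤ, ∀ᵐ p : ℝ × ℝ, φ (shift m n p) = factor N Λ m n p * φ p}
  zero_mem' := by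
    have h0 : ((0 : (ℝ × ℝ) →ₘ[volume] ℂ) : ℝ × ℝ → ℂ) =ᵐ[volume] 0 := AEEqFun.coeFn_zero
    refine ⟨(memLp_congr_ae (ae_restrict_of_ae h0)).2 MemLp.zero, fun m n => ?_⟩
    filter_upwards [h0, (measurePreserving_shift m n).quasiMeasurePreserving.ae h0] with p h1 h2
    simp [h1, h2]
  add_mem' := by
    rintro φ ψ ⟨hφ, hφ'⟩ ⟨hψ, hψ'⟩
    have h0 := AEEqFun.coeFn_add φ ψ
    refine ⟨(memLp_congr_ae (ae_restrict_of_ae h0)).2 (hφ.add hψ), fun m n => ?_⟩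
    filter_upwards [h0, (measurePreserving_shift m n).quasiMeasurePreserving.ae h0,
      hφ' m n, hψ' m n] with p h1 h2 h3 h4
    simp [h1, h2, h3, h4, mul_add]
  smul_mem' := by
    rintro c φ ⟨hφ, hφ'⟩
    have h0 := AEEqFun.coeFn_smul c φ
    refine ⟨(memLp_congr_ae (ae_restrict_of_ae h0)).2 (hφ.const_smul c), fun m n => ?_⟩
    filter_upwards [h0, (measurePreserving_shift m n).quasiMeasurePreserving.ae h0,
      hφ' m n] with p h1 h2 h3
    simp [h1, h2, h3]
    ring

/-- The Hilbert space `ℋ^Λ` of equivariant functions. -/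
def HSpace (N : ℤ) (Λ : AddChar (ℤ × ℤ) Circle) : Type := equivariant N Λ

variable {N : ℤ} {Λ : AddChar (ℤ × ℤ) Circle}

instance : AddCommGroup (HSpace N Λ) := inferInstanceAs (AddCommGroup (equivariant N Λ))

instance : Module ℂ (HSpace N Λ) := inferInstanceAs (Module ℂ (equivariant N Λ))

/-- A representative on `ℝ²` of an element of `ℋ^Λ`. -/
instance : CoeFun (HSpace N Λ) (fun _ => ℝ × ℝ → ℂ) := ⟨fun φ => (φ.1 : (ℝ × ℝ) →ₘ[volume] ℂ)⟩

lemma HSpace.ext {φ ψ : HSpace N Λ} (h : φ =ᵐ[volume] ψ) : φ = ψ :=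
  Subtype.ext (AEEqFun.ext h)

lemma HSpace.coeFn_add (φ ψ : HSpace N Λ) :
    ((φ + ψ : HSpace N Λ) : ℝ × ℝ → ℂ) =ᵐ[volume] fun p => φ p + ψ p :=
  AEEqFun.coeFn_add φ.1 ψ.1

lemma HSpace.coeFn_smul (c : ℂ) (φ : HSpace N Λ) :
    ((c • φ : HSpace N Λ) : ℝ × ℝ → ℂ) =ᵐ[volume] fun p => c * φ p :=
  AEEqFun.coeFn_smul c φ.1

/-- Restriction of equivariant functions to the fundamental domain. -/
def toL2 : HSpace N Λ →ₗ[ℂ] Lp ℂ 2 (volume.restrict cell) where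
  toFun φ := φ.2.1.toLp
  map_add' φ ψ := by
    rw [← MemLp.toLp_add]
    exact MemLp.toLp_congr _ _ (ae_restrict_of_ae (HSpace.coeFn_add φ ψ))
  map_smul' c φ := by
    rw [RingHom.id_apply, ← MemLp.toLp_const_smul]
    exact MemLp.toLp_congr _ _ (ae_restrict_of_ae (HSpace.coeFn_smul c φ))

lemma coeFn_toL2 (φ : HSpace N Λ) : toL2 φ =ᵐ[volume.restrict cell] φ :=
  MemLp.coeFn_toLp φ.2.1

/-- The integer `m` with `2πm ≤ x < 2π(m+1)`. -/
def idx (x : ℝ) : ℤ := ⌊x / (2 * Real.pi)⌋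

lemma measurable_idx : Measurable idx :=
  Int.measurable_floor.comp (measurable_id.div_const _)

/-- The representative in `[0, 2π)` of `x` modulo `2π`. -/
def base (x : ℝ) : ℝ := x - 2 * Real.pi * idx x

lemma base_mem (x : ℝ) : base x ∈ Ico 0 (2 * Real.pi) := by
  have hp : 0 < 2 * Real.pi := Real.two_pi_pos
  have h1 := Int.floor_le (x / (2 * Real.pi))
  have h2 := Int.lt_floor_add_one (x / (2 * Real.pi))
  rw [le_div_iff₀ hp] at h1
  rw [div_lt_iff₀ hp] at h2
  constructor <;> simp only [base, idx] <;> nlinarith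

lemma idx_add (x : ℝ) (m : ℤ) : idx (x + 2 * Real.pi * m) = idx x + m := by
  have hp : 2 * Real.pi ≠ 0 := Real.two_pi_pos.ne'
  rw [idx, add_div, mul_div_cancel_left₀ _ hp, Int.floor_add_intCast, idx]

lemma base_add (x : ℝ) (m : ℤ) : base (x + 2 * Real.pi * m) = base x := by
  rw [base, idx_add, base]; push_cast; ring

lemma idx_eq_zero {x : ℝ} (h : x ∈ Ioo 0 (2 * Real.pi)) : idx x = 0 := by
  rw [idx, Int.floor_eq_zero_iff]
  exact ⟨div_nonneg h.1.le Real.two_pi_pos.le, (div_lt_one Real.two_pi_pos).2 h.2⟩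

lemma shift_base (p : ℝ × ℝ) : shift (idx p.1) (idx p.2) (base p.1, base p.2) = p := by
  simp [shift, base]

lemma ae_cell_eq : (cell : Set (ℝ × ℝ)) =ᵐ[volume]
    (Ico 0 (2 * Real.pi) ×ˢ Ico 0 (2 * Real.pi) : Set (ℝ × ℝ)) :=
  Measure.set_prod_ae_eq Ioo_ae_eq_Ico Ioo_ae_eq_Ico

lemma toL2_injective : Function.Injective (toL2 : HSpace N Λ →ₗ[ℂ] _) := by
  rw [← LinearMap.ker_eq_bot, LinearMap.ker_eq_bot']
  intro φ h
  have h1 : ∀ᵐ p ∂(volume.restrict cell), φ p = 0 := by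
    filter_upwards [coeFn_toL2 φ, Lp.coeFn_zero ℂ 2 (volume.restrict cell)] with p h2 h3
    rw [← h2, h, h3]; rfl
  rw [Measure.restrict_congr_set ae_cell_eq,
    ae_restrict_iff' (measurableSet_Ico.prod measurableSet_Ico)] at h1
  have h2 : ∀ m n : ℤ, ∀ᵐ p : ℝ × ℝ, (shift (-m) (-n) p ∈
      (Ico 0 (2 * Real.pi) ×ˢ Ico 0 (2 * Real.pi) : Set (ℝ × ℝ))) → φ p = 0 := by
    intro m n
    filter_upwards [(measurePreserving_shift (-m) (-n)).quasiMeasurePreserving.ae h1,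
      (measurePreserving_shift (-m) (-n)).quasiMeasurePreserving.ae (φ.2.2 m n)] with p h3 h4 h5
    have h6 : shift m n (shift (-m) (-n) p) = p := by simp [shift]
    rw [h6] at h4
    rw [h4, h3 h5, mul_zero]
  have h3 : ∀ᵐ p : ℝ × ℝ, ∀ m n : ℤ, (shift (-m) (-n) p ∈
      (Ico 0 (2 * Real.pi) ×ˢ Ico 0 (2 * Real.pi) : Set (ℝ × ℝ))) → φ p = 0 :=
    ae_all_iff.2 fun m => ae_all_iff.2 fun n => h2 m n
  apply HSpace.ext
  filter_upwards [h3, AEEqFun.coeFn_zero (α := ℝ × ℝ) (β := ℂ) (μ := volume)] with p h4 h5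
  rw [h4 (idx p.1) (idx p.2)]
  · exact h5.symm
  · have h6 : shift (-idx p.1) (-idx p.2) p = (base p.1, base p.2) := by
      simp [shift, base, sub_eq_add_neg]
    rw [h6]
    exact ⟨base_mem _, base_mem _⟩

/-- The norm of `ℋ^Λ` is the one of `L²(D)`. -/
instance : NormedAddCommGroup (HSpace N Λ) :=
  NormedAddCommGroup.induced (HSpace N Λ) (Lp ℂ 2 (volume.restrict cell)) toL2 toL2_injective

/-- The scalar product of `ℋ^Λ` is the one of `L²(D)`; see `inner_eq`. -/
instance : InnerProductSpace ℂ (HSpace N Λ) where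
  toNormedSpace := NormedSpace.induced ℂ (HSpace N Λ) (Lp ℂ 2 (volume.restrict cell)) toL2
  inner φ ψ := inner ℂ (toL2 φ) (toL2 ψ)
  norm_sq_eq_re_inner φ := InnerProductSpace.norm_sq_eq_re_inner (𝕜 := ℂ) (toL2 φ)
  conj_inner_symm φ ψ := inner_conj_symm _ _
  add_left φ ψ χ := by rw [map_add, inner_add_left]
  smul_left φ ψ c := by rw [map_smul, inner_smul_left]

lemma inner_eq (φ ψ : HSpace N Λ) :
    inner ℂ φ ψ = ∫ p in cell, conj (φ p) * ψ p := by
  change inner ℂ (toL2 φ) (toL2 ψ) = _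
  rw [L2.inner_def]
  refine integral_congr_ae ?_
  filter_upwards [coeFn_toL2 φ, coeFn_toL2 ψ] with p h1 h2
  simp [h1, h2, mul_comm]

lemma factor_cocycle (k l m n : ℤ) (p : ℝ × ℝ) :
    factor N Λ (k + m) (l + n) p = factor N Λ m n (shift k l p) * factor N Λ k l p := by
  have h1 : ((k + m, l + n) : ℤ × ℤ) = (m, n) + (k, l) := by ext <;> simp [add_comm]
  have h2 : Complex.exp (-(Complex.I * m * N * (p.2 + 2 * Real.pi * l))) =
      Complex.exp (-(Complex.I * m * N * p.2)) := by
    rw [Complex.exp_eq_exp_iff_exists_int]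
    exact ⟨-(m * N * l), by push_cast; ring⟩
  simp only [factor, shift]
  rw [h1, AddChar.map_add_eq_mul]
  push_cast
  rw [h2, mul_mul_mul_comm, ← Complex.exp_add]
  ring_nf

lemma toL2_surjective : Function.Surjective (toL2 : HSpace N Λ →ₗ[ℂ] _) := by
  intro g
  obtain ⟨g', hg', hgg'⟩ := (Lp.memLp g).1
  set f : ℝ × ℝ → ℂ := fun p =>
    factor N Λ (idx p.1) (idx p.2) (base p.1, base p.2) * g' (base p.1, base p.2) with hf
  have hb : Measurable base := by
    unfold base
    exact measurable_id.sub (measurable_const.mul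
      ((measurable_from_top (f := fun k : ℤ => (k : ℝ))).comp measurable_idx))
  have hB : Measurable fun p : ℝ × ℝ => (base p.1, base p.2) :=
    (hb.comp measurable_fst).prodMk (hb.comp measurable_snd)
  have hfm : Measurable f := by
    refine Measurable.mul ?_ (hg'.measurable.comp hB)
    have h1 : Measurable fun p : ℝ × ℝ => ((idx p.1, idx p.2) : ℤ × ℤ) :=
      (measurable_idx.comp measurable_fst).prodMk (measurable_idx.comp measurable_snd)
    have h2 : Measurable fun q : (ℤ × ℤ) × (ℝ × ℝ) => factor N Λ q.1.1 q.1.2 q.2 := by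
      refine measurable_from_prod_countable_right fun a => ?_
      unfold factor
      fun_prop
    exact h2.comp (h1.prodMk hB)
  have hfe : ∀ (m n : ℤ) (p : ℝ × ℝ), f (shift m n p) = factor N Λ m n p * f p := by
    intro m n p
    have h1 : (shift m n p).1 = p.1 + 2 * Real.pi * m := rfl
    have h2 : (shift m n p).2 = p.2 + 2 * Real.pi * n := rfl
    simp only [hf, h1, h2, base_add, idx_add, factor_cocycle, shift_base]
    ring
  have hfc : f =ᵐ[volume.restrict cell] g := by
    have hcm : MeasurableSet (cell : Set (ℝ × ℝ)) := measurableSet_Ioo.prod measurableSet_Ioo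
    filter_upwards [hgg', ae_restrict_mem hcm] with p h1 h2
    rw [h1]
    simp [hf, base, idx_eq_zero h2.1, idx_eq_zero h2.2, factor]
    have : ((0, 0) : ℤ × ℤ) = 0 := rfl
    simp [this]
  have hmk := AEEqFun.coeFn_mk f (μ := volume) hfm.aestronglyMeasurable
  have hmk' : AEEqFun.mk f hfm.aestronglyMeasurable =ᵐ[volume.restrict cell] f :=
    ae_restrict_of_ae hmk
  refine ⟨⟨AEEqFun.mk f hfm.aestronglyMeasurable, ?_, fun m n => ?_⟩, ?_⟩
  · exact (memLp_congr_ae (hmk'.trans hfc)).2 (Lp.memLp g)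
  · filter_upwards [hmk, (measurePreserving_shift m n).quasiMeasurePreserving.ae hmk] with p h1 h2
    rw [h1, h2, hfe]
  · apply Lp.ext
    exact (coeFn_toL2 _).trans (hmk'.trans hfc)

/-- Restriction to `D` as a unitary map onto `L²(D)`. -/
def toL2Equiv : HSpace N Λ ≃ₗᵢ[ℂ] Lp ℂ 2 (volume.restrict cell) where
  toLinearEquiv := LinearEquiv.ofBijective toL2 ⟨toL2_injective, toL2_surjective⟩
  norm_map' _ := rfl

instance : CompleteSpace (HSpace N Λ) :=
  (completeSpace_congr (e := (toL2Equiv (N := N) (Λ := Λ)).toLinearEquiv.toEquiv)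
    (toL2Equiv (N := N) (Λ := Λ)).isometry.isUniformEmbedding).2 inferInstance

/-! ### The Hamiltonian -/

/-- The covariant derivative `∂_x`. -/
def covX (f : ℝ × ℝ → ℂ) (p : ℝ × ℝ) : ℂ := fderiv ℝ f p (1, 0)

/-- The covariant derivative `∂_y + (i N / 2π) x`. -/
def covY (N : ℤ) (f : ℝ × ℝ → ℂ) (p : ℝ × ℝ) : ℂ :=
  fderiv ℝ f p (0, 1) + Complex.I * N / (2 * Real.pi) * p.1 * f p

/-- The differential expression `-∂_x² - (∂_y + (i N / 2π) x)²`. -/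
def diffOp (N : ℤ) (f : ℝ × ℝ → ℂ) (p : ℝ × ℝ) : ℂ :=
  -covX (covX f) p - covY N (covY N f) p

lemma contDiff_covX {f : ℝ × ℝ → ℂ} (hf : ContDiff ℝ ∞ f) : ContDiff ℝ ∞ (covX f) :=
  (hf.fderiv_right (m := ∞) (by simp)).clm_apply contDiff_const

lemma contDiff_covY {f : ℝ × ℝ → ℂ} (hf : ContDiff ℝ ∞ f) : ContDiff ℝ ∞ (covY N f) := by
  refine ((hf.fderiv_right (m := ∞) (by simp)).clm_apply contDiff_const).add
    (ContDiff.mul (contDiff_const.mul ?_) hf)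
  exact Complex.ofRealCLM.contDiff.comp contDiff_fst

lemma contDiff_diffOp {f : ℝ × ℝ → ℂ} (hf : ContDiff ℝ ∞ f) : ContDiff ℝ ∞ (diffOp N f) :=
  (contDiff_covX (contDiff_covX hf)).neg.sub (contDiff_covY (contDiff_covY hf))

lemma fderiv_equivariant {f : ℝ × ℝ → ℂ} (hf : ContDiff ℝ ∞ f) {m n : ℤ}
    (h : ∀ p, f (shift m n p) = factor N Λ m n p * f p) (p v : ℝ × ℝ) :
    fderiv ℝ f (shift m n p) v =
      factor N Λ m n p * (fderiv ℝ f p v - Complex.I * m * N * v.2 * f p) := by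
  have hd : Differentiable ℝ f := hf.differentiable (by simp)
  have h1 : fderiv ℝ (fun q => f (shift m n q)) p = fderiv ℝ f (shift m n p) := by
    have : (fun q => f (shift m n q)) =
        fun q => f (q + (2 * Real.pi * m, 2 * Real.pi * n)) := rfl
    rw [this, fderiv_comp_add_right]; rfl
  have h2 : HasFDerivAt (fun q : ℝ × ℝ => factor N Λ m n q)
      ((factor N Λ m n p * -(Complex.I * m * N)) •
        (Complex.ofRealCLM.comp (ContinuousLinearMap.snd ℝ ℝ ℝ))) p := by
    have h3 : HasFDerivAt (fun q : ℝ × ℝ => (q.2 : ℂ))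
        (Complex.ofRealCLM.comp (ContinuousLinearMap.snd ℝ ℝ ℝ)) p :=
      (Complex.ofRealCLM.comp (ContinuousLinearMap.snd ℝ ℝ ℝ)).hasFDerivAt
    have h4 := ((h3.const_mul (Complex.I * m * N)).neg.cexp).const_mul (Λ (m, n) : ℂ)
    refine HasFDerivAt.congr_fderiv (f := fun q : ℝ × ℝ => factor N Λ m n q) h4 ?_
    apply ContinuousLinearMap.ext
    intro v
    simp [factor]
    ring
  have h5 : (fun q => f (shift m n q)) = (fun q => factor N Λ m n q) * f := funext h
  rw [← h1, h5, (h2.mul (hd p).hasFDerivAt).fderiv]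
  simp
  ring

lemma covX_equivariant {f : ℝ × ℝ → ℂ} (hf : ContDiff ℝ ∞ f) {m n : ℤ}
    (h : ∀ p, f (shift m n p) = factor N Λ m n p * f p) (p : ℝ × ℝ) :
    covX f (shift m n p) = factor N Λ m n p * covX f p := by
  simp [covX, fderiv_equivariant hf h]

lemma covY_equivariant {f : ℝ × ℝ → ℂ} (hf : ContDiff ℝ ∞ f) {m n : ℤ}
    (h : ∀ p, f (shift m n p) = factor N Λ m n p * f p) (p : ℝ × ℝ) :
    covY N f (shift m n p) = factor N Λ m n p * covY N f p := by
  have hp : (Real.pi : ℂ) ≠ 0 := Complex.ofReal_ne_zero.2 Real.pi_ne_zero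
  have h1 : (shift m n p).1 = p.1 + 2 * Real.pi * m := rfl
  rw [covY, fderiv_equivariant hf h, h, h1, covY]
  push_cast
  field_simp
  ring

lemma diffOp_equivariant {f : ℝ × ℝ → ℂ} (hf : ContDiff ℝ ∞ f) {m n : ℤ}
    (h : ∀ p, f (shift m n p) = factor N Λ m n p * f p) (p : ℝ × ℝ) :
    diffOp N f (shift m n p) = factor N Λ m n p * diffOp N f p := by
  rw [diffOp, covX_equivariant (contDiff_covX hf) (covX_equivariant hf h),
    covY_equivariant (contDiff_covY hf) (covY_equivariant hf h), diffOp]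
  ring

/-- The element of `ℋ^Λ` given by a continuous equivariant function. -/
def ofContinuous (f : ℝ × ℝ → ℂ) (hf : Continuous f)
    (h : ∀ m n p, f (shift m n p) = factor N Λ m n p * f p) : HSpace N Λ :=
  ⟨AEEqFun.mk f hf.aestronglyMeasurable, by
    have hmk := AEEqFun.coeFn_mk f (μ := volume) hf.aestronglyMeasurable
    refine ⟨(memLp_congr_ae (ae_restrict_of_ae hmk)).2 ?_, fun m n => ?_⟩
    · have hK : IsCompact (Icc 0 (2 * Real.pi) ×ˢ Icc 0 (2 * Real.pi) : Set (ℝ × ℝ)) :=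
        isCompact_Icc.prod isCompact_Icc
      have hs : (cell : Set (ℝ × ℝ)) ⊆ Icc 0 (2 * Real.pi) ×ˢ Icc 0 (2 * Real.pi) :=
        prod_mono Ioo_subset_Icc_self Ioo_subset_Icc_self
      obtain ⟨C, hC⟩ := hK.exists_bound_of_continuousOn hf.continuousOn
      have : IsFiniteMeasure ((volume : Measure (ℝ × ℝ)).restrict cell) :=
        ⟨by rw [Measure.restrict_apply_univ]
            exact (measure_mono hs).trans_lt hK.measure_lt_top⟩
      refine MemLp.of_bound hf.aestronglyMeasurable C ?_
      filter_upwards [ae_restrict_mem (measurableSet_Ioo.prod measurableSet_Ioo)] with p hp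
      exact hC p (hs hp)
    · filter_upwards [hmk, (measurePreserving_shift m n).quasiMeasurePreserving.ae hmk]
        with p h1 h2
      rw [h1, h2, h]⟩

lemma coeFn_ofContinuous (f : ℝ × ℝ → ℂ) (hf : Continuous f)
    (h : ∀ m n p, f (shift m n p) = factor N Λ m n p * f p) :
    ofContinuous f hf h =ᵐ[volume] f :=
  AEEqFun.coeFn_mk f hf.aestronglyMeasurable

/-- The smooth elements of `ℋ^Λ`: the classes of `C^∞` functions on `ℝ²`. -/
def smoothDomain (N : ℤ) (Λ : AddChar (ℤ × ℤ) Circle) : Submodule ℂ (HSpace N Λ) where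
  carrier := {φ | ∃ f : ℝ × ℝ → ℂ, ContDiff ℝ ∞ f ∧ φ =ᵐ[volume] f}
  zero_mem' := ⟨0, contDiff_const, AEEqFun.coeFn_zero⟩
  add_mem' := by
    rintro φ ψ ⟨f, hf, hφ⟩ ⟨g, hg, hψ⟩
    refine ⟨f + g, hf.add hg, ?_⟩
    filter_upwards [HSpace.coeFn_add φ ψ, hφ, hψ] with p h1 h2 h3
    simp [h1, h2, h3]
  smul_mem' := by
    rintro c φ ⟨f, hf, hφ⟩
    refine ⟨c • f, contDiff_const.smul hf, ?_⟩
    filter_upwards [HSpace.coeFn_smul c φ, hφ] with p h1 h2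
    simp [h1, h2]

/-- The (unique) smooth representative. -/
def rep (φ : smoothDomain N Λ) : ℝ × ℝ → ℂ := φ.2.choose

lemma contDiff_rep (φ : smoothDomain N Λ) : ContDiff ℝ ∞ (rep φ) := φ.2.choose_spec.1

lemma ae_eq_rep (φ : smoothDomain N Λ) : φ.1 =ᵐ[volume] rep φ := φ.2.choose_spec.2

lemma rep_eq (φ : smoothDomain N Λ) {f : ℝ × ℝ → ℂ} (hf : Continuous f)
    (h : φ.1 =ᵐ[volume] f) : rep φ = f :=
  ((contDiff_rep φ).continuous.ae_eq_iff_eq volume hf).1 ((ae_eq_rep φ).symm.trans h)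

lemma rep_equivariant (φ : smoothDomain N Λ) (m n : ℤ) (p : ℝ × ℝ) :
    rep φ (shift m n p) = factor N Λ m n p * rep φ p := by
  have hs : Continuous (shift m n) := by unfold shift; fun_prop
  have hF : Continuous (factor N Λ m n) := by unfold factor; fun_prop
  have hc := (contDiff_rep φ).continuous
  refine congrFun (((hc.comp hs).ae_eq_iff_eq volume (hF.mul hc)).1 ?_) p
  filter_upwards [φ.1.2.2 m n, ae_eq_rep φ,
    (measurePreserving_shift m n).quasiMeasurePreserving.ae (ae_eq_rep φ)] with q h1 h2 h3
  rw [Function.comp_apply, ← h3, h1, h2]; rfl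

lemma rep_add (φ ψ : smoothDomain N Λ) : rep (φ + ψ) = rep φ + rep ψ := by
  refine rep_eq _ ((contDiff_rep φ).add (contDiff_rep ψ)).continuous ?_
  filter_upwards [HSpace.coeFn_add φ.1 ψ.1, ae_eq_rep φ, ae_eq_rep ψ] with p h1 h2 h3
  simp [h1, h2, h3]

lemma rep_smul (c : ℂ) (φ : smoothDomain N Λ) : rep (c • φ) = c • rep φ := by
  refine rep_eq _ (contDiff_const.smul (contDiff_rep φ)).continuous ?_
  filter_upwards [HSpace.coeFn_smul c φ.1, ae_eq_rep φ] with p h1 h2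
  simp [h1, h2]

lemma covX_add {f g : ℝ × ℝ → ℂ} (hf : ContDiff ℝ ∞ f) (hg : ContDiff ℝ ∞ g) :
    covX (f + g) = covX f + covX g := by
  funext p
  simp [covX, fderiv_add (hf.differentiable (by simp) p) (hg.differentiable (by simp) p)]

lemma covX_smul (c : ℂ) {f : ℝ × ℝ → ℂ} (hf : ContDiff ℝ ∞ f) :
    covX (c • f) = c • covX f := by
  funext p
  simp [covX, fderiv_const_smul (hf.differentiable (by simp) p)]

lemma covY_add {f g : ℝ × ℝ → ℂ} (hf : ContDiff ℝ ∞ f) (hg : ContDiff ℝ ∞ g) :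
    covY N (f + g) = covY N f + covY N g := by
  funext p
  simp [covY, fderiv_add (hf.differentiable (by simp) p) (hg.differentiable (by simp) p)]
  ring

lemma covY_smul (c : ℂ) {f : ℝ × ℝ → ℂ} (hf : ContDiff ℝ ∞ f) :
    covY N (c • f) = c • covY N f := by
  funext p
  simp [covY, fderiv_const_smul (hf.differentiable (by simp) p)]
  ring

/-- The operator `φ ↦ -∂_x² φ - (∂_y + (i N / 2π) x)² φ` defined on the smooth elements of
`ℋ^Λ`. -/
def smoothHamiltonian (N : ℤ) (Λ : AddChar (ℤ × ℤ) Circle) :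
    HSpace N Λ →ₗ.[ℂ] HSpace N Λ where
  domain := smoothDomain N Λ
  toFun :=
    { toFun := fun φ => ofContinuous (diffOp N (rep φ))
        (contDiff_diffOp (contDiff_rep φ)).continuous
        fun _ _ => diffOp_equivariant (contDiff_rep φ) (rep_equivariant φ _ _)
      map_add' := by
        intro φ ψ
        apply HSpace.ext
        refine (coeFn_ofContinuous _ _ _).trans ?_
        have hφ := contDiff_rep φ
        have hψ := contDiff_rep ψ
        have h : diffOp N (rep (φ + ψ)) = diffOp N (rep φ) + diffOp N (rep ψ) := by
          funext p
          simp only [diffOp, rep_add, covX_add hφ hψ, covY_add hφ hψ, Pi.add_apply,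
            covX_add (contDiff_covX hφ) (contDiff_covX hψ),
            covY_add (contDiff_covY hφ) (contDiff_covY hψ)]
          ring
        rw [h]
        refine EventuallyEq.symm ((HSpace.coeFn_add _ _).trans ?_)
        exact (coeFn_ofContinuous _ _ _).add (coeFn_ofContinuous _ _ _)
      map_smul' := by
        intro c φ
        apply HSpace.ext
        refine (coeFn_ofContinuous _ _ _).trans ?_
        have hφ := contDiff_rep φ
        have h : diffOp N (rep (c • φ)) = c • diffOp N (rep φ) := by
          funext p
          simp only [diffOp, rep_smul, covX_smul c hφ, covY_smul c hφ, Pi.smul_apply,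
            covX_smul c (contDiff_covX hφ), covY_smul c (contDiff_covY hφ), smul_eq_mul]
          ring
        rw [h]
        refine EventuallyEq.symm ((HSpace.coeFn_smul _ _).trans ?_)
        filter_upwards [coeFn_ofContinuous (diffOp N (rep φ))
          (contDiff_diffOp (contDiff_rep φ)).continuous
          fun _ _ => diffOp_equivariant (contDiff_rep φ) (rep_equivariant φ _ _)] with p h1
        simp [h1] }

/-- The Hamiltonian `H^Λ`. -/
def hamiltonian (N : ℤ) (Λ : AddChar (ℤ × ℤ) Circle) : HSpace N Λ →ₗ.[ℂ] HSpace N Λ :=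
  friedrichs (smoothHamiltonian N Λ)

end MagneticTorus

end

/-! Expand an element of `ℋ¹` in a Fourier series in `y`. Translation of `x` by `2π` shifts the
frequency by `N`, so the coefficients with frequencies in one residue class mod `N` are translates
of a single function on the line. The space thus splits into `|N|` copies of `L²(ℝ)`, on each of
which the Hamiltonian acts as the harmonic oscillator `-d²/dX² + β²X²` with `β = |N|/2π` (`field
N`). Its levels are `β(2l+1) = (|N|/π)(l+1/2)`.

The splitting is made explicit by theta series. For a polynomial `p` and a residue `r`, `theta N r
p` periodizes `p(X) exp(-βX²/2)`; the differential operator acts on it through `p` alone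
(`diffOp_theta`), and Hermite polynomials diagonalize that action (`oscillator_hermitePoly`).
Totality (`eq_zero_of_orthogonal_theta`) comes from unfolding an integral over the cell to a strip,
passing from polynomials times a Gaussian to exponentials times a Gaussian, and then using
uniqueness for the Fourier transform in `x` and Fourier series in `y`.

A symmetric operator whose domain contains a Hilbert basis of its eigenvectors has as Friedrichs
extension the maximal diagonal operator in that basis (`isDiag_friedrichs`). Spectrum and
multiplicities are then read off from the eigenvalues (`IsDiag.spec_eq`,
`IsDiag.finrank_eigenspace`).

For a general character, a translation in `x` and `y` combined with the gauge factor `exp(iνy)`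
preserves the covariant derivatives (`covY_magTrans`) and turns the trivial character into `Λ`. It
carries the eigenbasis of `ℋ¹` to one of `ℋ^Λ` with the same eigenvalues (`isDiag_hamiltonian`), and
two operators diagonal in the same basis with the same eigenvalues coincide, domains included. -/

noncomputable section

namespace MagneticTorus

/-! ### Diagonal operators -/

section Diagonal

variable {E F ι : Type*} [NormedAddCommGroup E] [InnerProductSpace ℂ E]
  [NormedAddCommGroup F] [InnerProductSpace ℂ F]

/-- The operator `H` is the maximal diagonal operator with eigenvalues `lam i` in the Hilbert
basis `b`. -/
def IsDiag (H : E →ₗ.[ℂ] E) (b : HilbertBasis ι ℂ E) (lam : ι → ℂ) : Prop :=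
  ∀ φ χ : E, (∃ h : φ ∈ H.domain, H ⟨φ, h⟩ = χ) ↔
    ∀ i, inner ℂ (b i) χ = lam i * inner ℂ (b i) φ

lemma HilbertBasis.ext_inner (b : HilbertBasis ι ℂ E) {x y : E}
    (h : ∀ i, inner ℂ (b i) x = inner ℂ (b i) y) : x = y := by
  apply b.repr.injective
  ext i
  rw [b.repr_apply_apply, b.repr_apply_apply, h]

/-- `IsDiag` describes the graph of the operator, hence its domain and its values at once. Every
equality of unbounded operators in the main theorem is reduced to this. -/
lemma IsDiag.unique {H K : E →ₗ.[ℂ] E} {b : HilbertBasis ι ℂ E} {lam : ι → ℂ}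
    (hH : IsDiag H b lam) (hK : IsDiag K b lam) : H = K := by
  have h : ∀ φ χ : E, (∃ h : φ ∈ H.domain, H ⟨φ, h⟩ = χ) ↔ ∃ h : φ ∈ K.domain, K ⟨φ, h⟩ = χ :=
    fun φ χ => (hH φ χ).trans (hK φ χ).symm
  refine LinearPMap.ext ?_ ?_
  · ext φ
    exact ⟨fun hφ => ((h φ _).1 ⟨hφ, rfl⟩).1, fun hφ => ((h φ _).2 ⟨hφ, rfl⟩).1⟩
  · intro φ h1 h2
    obtain ⟨h3, h4⟩ := (h φ _).1 ⟨h1, rfl⟩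
    exact h4.symm

/-- The image of a Hilbert basis under a unitary map. -/
def mapBasis (b : HilbertBasis ι ℂ E) (U : E ≃ₗᵢ[ℂ] F) : HilbertBasis ι ℂ F :=
  HilbertBasis.ofRepr (U.symm.trans b.repr)

lemma mapBasis_apply (b : HilbertBasis ι ℂ E) (U : E ≃ₗᵢ[ℂ] F) (i : ι) :
    mapBasis b U i = U (b i) := by
  classical
  rw [← HilbertBasis.repr_symm_single, ← HilbertBasis.repr_symm_single]
  rfl

lemma inner_mapBasis (b : HilbertBasis ι ℂ E) (U : E ≃ₗᵢ[ℂ] F) (i : ι) (x : F) :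
    inner ℂ (mapBasis b U i) x = inner ℂ (b i) (U.symm x) := by
  rw [mapBasis_apply, ← U.inner_map_map, U.apply_symm_apply]

lemma IsDiag.conjugate {H : E →ₗ.[ℂ] E} {b : HilbertBasis ι ℂ E} {lam : ι → ℂ}
    (hH : IsDiag H b lam) (U : E ≃ₗᵢ[ℂ] F) :
    IsDiag (MagneticTorus.conjugate U H) (mapBasis b U) lam := by
  intro φ χ
  simp only [inner_mapBasis]
  rw [← hH]
  constructor
  · rintro ⟨h, rfl⟩
    refine ⟨h, ?_⟩
    change _ = U.symm (U (H _))
    rw [U.symm_apply_apply]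
    rfl
  · rintro ⟨h, h'⟩
    refine ⟨h, ?_⟩
    change U (H ⟨U.symm φ, h⟩) = χ
    rw [h', U.apply_symm_apply]

/-! ### Symmetric operators with an eigenbasis in their domain -/

lemma inner_diag_symm {A : E →ₗ.[ℂ] E} {b : HilbertBasis ι ℂ E} {lam : ι → ℝ}
    (hA : ∀ φ ψ : A.domain, inner ℂ (A φ) (ψ : E) = inner ℂ (φ : E) (A ψ))
    (hb : ∀ i, ∃ h : b i ∈ A.domain, A ⟨b i, h⟩ = (lam i : ℂ) • b i) (i : ι) (φ : A.domain) :
    inner ℂ (b i) (A φ) = (lam i : ℂ) * inner ℂ (b i) (φ : E) := by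
  obtain ⟨h, h'⟩ := hb i
  have := hA ⟨b i, h⟩ φ
  rw [h', inner_smul_left, Complex.conj_ofReal] at this
  exact this.symm

lemma inner_adjoint_diag [CompleteSpace E] {A : E →ₗ.[ℂ] E} (hd : Dense (A.domain : Set E))
    {b : HilbertBasis ι ℂ E} {lam : ι → ℝ}
    (hb : ∀ i, ∃ h : b i ∈ A.domain, A ⟨b i, h⟩ = (lam i : ℂ) • b i) (i : ι)
    (ψ : A.adjoint.domain) :
    inner ℂ (b i) (A.adjoint ψ) = (lam i : ℂ) * inner ℂ (b i) (ψ : E) := by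
  obtain ⟨h, h'⟩ := hb i
  have := LinearPMap.adjoint_isFormalAdjoint hd ψ ⟨b i, h⟩
  rw [← inner_conj_symm, this, h', inner_smul_right, map_mul, inner_conj_symm, Complex.conj_ofReal]

/-- Finite partial sums of the expansion of `φ` lie in the domain, and `A` sends them to the partial
sums of `χ`. Both sequences converge, so the form evaluated on differences tends to zero. -/
lemma mem_formDomain_of_diag [Countable ι] {A : E →ₗ.[ℂ] E} {b : HilbertBasis ι ℂ E} {lam : ι → ℝ}
    (hb : ∀ i, ∃ h : b i ∈ A.domain, A ⟨b i, h⟩ = (lam i : ℂ) • b i) {φ χ : E}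
    (hφ : ∀ i, inner ℂ (b i) χ = (lam i : ℂ) * inner ℂ (b i) φ) : φ ∈ formDomain A := by
  refine Submodule.subset_span ?_
  -- Countability of `ι` replaces the net of finite partial sums by a sequence, as `formDomain`
  -- requires.
  obtain ⟨s, hs⟩ := Filter.exists_seq_tendsto (atTop : Filter (Finset ι))
  choose h h' using hb
  set u : ℕ → A.domain := fun n => ∑ i ∈ s n, b.repr φ i • ⟨b i, h i⟩ with hu
  have hu1 : ∀ n, (u n : E) = ∑ i ∈ s n, b.repr φ i • b i := by
    intro n; simp [hu]
  have hu2 : ∀ n, A (u n) = ∑ i ∈ s n, b.repr χ i • b i := by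
    intro n
    rw [hu]
    change A.toFun _ = _
    rw [map_sum]
    refine Finset.sum_congr rfl fun i _ => ?_
    rw [map_smul]
    change _ • A ⟨b i, h i⟩ = _
    rw [h', smul_smul, b.repr_apply_apply, b.repr_apply_apply, hφ, mul_comm]
  have t1 : Tendsto (fun n => (u n : E)) atTop (𝓝 φ) := by
    simp only [hu1]; exact (b.hasSum_repr φ).comp hs
  have t2 : Tendsto (fun n => A (u n)) atTop (𝓝 χ) := by
    simp only [hu2]; exact (b.hasSum_repr χ).comp hs
  have t1' : Tendsto (fun p : ℕ × ℕ => (u p.1 : E) - u p.2) atTop (𝓝 (φ - φ)) := by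
    rw [← prod_atTop_atTop_eq]
    exact (t1.comp tendsto_fst).sub (t1.comp tendsto_snd)
  have t2' : Tendsto (fun p : ℕ × ℕ => A (u p.1) - A (u p.2)) atTop (𝓝 (χ - χ)) := by
    rw [← prod_atTop_atTop_eq]
    exact (t2.comp tendsto_fst).sub (t2.comp tendsto_snd)
  refine ⟨u, t1, ?_⟩
  have := t1'.inner (𝕜 := ℂ) t2'
  rw [sub_self, sub_self, inner_zero_left] at this
  refine this.congr fun p => ?_
  rw [LinearPMap.map_sub]
  rfl

/-- The adjoint is already the maximal diagonal operator, and every vector of its domain lies in the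
form domain, so the restriction defining `friedrichs` removes nothing. -/
theorem isDiag_friedrichs [CompleteSpace E] [Countable ι] {A : E →ₗ.[ℂ] E}
    (hA : ∀ φ ψ : A.domain, inner ℂ (A φ) (ψ : E) = inner ℂ (φ : E) (A ψ))
    {b : HilbertBasis ι ℂ E} {lam : ι → ℝ}
    (hb : ∀ i, ∃ h : b i ∈ A.domain, A ⟨b i, h⟩ = (lam i : ℂ) • b i) :
    IsDiag (friedrichs A) b (fun i => (lam i : ℂ)) := by
  have hd : Dense (A.domain : Set E) := by
    have h1 : (Submodule.span ℂ (range b) : Set E) ⊆ A.domain := by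
      refine (Submodule.span_le (p := A.domain)).2 ?_
      rintro _ ⟨i, rfl⟩
      exact (hb i).1
    refine Dense.mono h1 ?_
    rw [← Submodule.dense_iff_topologicalClosure_eq_top.symm.eq]
    exact b.dense_span
  intro φ χ
  constructor
  · rintro ⟨h, rfl⟩ i
    exact inner_adjoint_diag hd hb i ⟨φ, h.2⟩
  · intro hφ
    -- Parseval on both sides: the real factor `lam i` moves from the coefficient of `φ` to that of
    -- `x`.
    have h1 : ∀ x : A.domain, inner ℂ χ (x : E) = inner ℂ φ (A x) := by
      intro x
      rw [← b.tsum_inner_mul_inner, ← b.tsum_inner_mul_inner]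
      refine tsum_congr fun i => ?_
      rw [inner_diag_symm hA hb, ← inner_conj_symm χ, hφ, map_mul, Complex.conj_ofReal,
        inner_conj_symm]
      ring
    have h2 : φ ∈ A.adjoint.domain := A.mem_adjoint_domain_of_exists φ ⟨χ, h1⟩
    refine ⟨⟨mem_formDomain_of_diag hb hφ, h2⟩, ?_⟩
    exact LinearPMap.adjoint_apply_eq hd ⟨φ, h2⟩ h1

/-! ### Bounded multipliers, eigenspaces and spectrum of diagonal operators -/

lemma exists_diagonal_clm (b : HilbertBasis ι ℂ E) (d : ι → ℂ) {C : ℝ} (hC : ∀ i, ‖d i‖ ≤ C) :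
    ∃ R : E →L[ℂ] E, ∀ x i, inner ℂ (b i) (R x) = d i * inner ℂ (b i) x := by
  have hs : ∀ x : lp (fun _ : ι => ℂ) 2, Summable fun i => ‖x i‖ ^ 2 := fun x => by
    simpa using (lp.memℓp x).summable (by norm_num)
  have hle : ∀ (x : lp (fun _ : ι => ℂ) 2) i, ‖d i * x i‖ ^ 2 ≤ C ^ 2 * ‖x i‖ ^ 2 := by
    intro x i
    rw [norm_mul, mul_pow]
    gcongr
    exact hC i
  have hm : ∀ x : lp (fun _ : ι => ℂ) 2, Memℓp (fun i => d i * x i) 2 := by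
    intro x
    refine memℓp_gen ?_
    simpa using Summable.of_nonneg_of_le (fun i => by positivity) (hle x) ((hs x).mul_left (C ^ 2))
  let L : lp (fun _ : ι => ℂ) 2 →ₗ[ℂ] lp (fun _ : ι => ℂ) 2 :=
    { toFun := fun x => ⟨_, hm x⟩
      map_add' := fun x y => by
        ext i; exact mul_add _ _ _
      map_smul' := fun c x => by
        ext i; exact mul_left_comm _ _ _ }
  have hn : ∀ y : lp (fun _ : ι => ℂ) 2, ‖y‖ ^ 2 = ∑' i, ‖y i‖ ^ 2 := fun y => by
    simpa using lp.norm_rpow_eq_tsum (p := 2) (by norm_num) y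
  have hL : ∀ x, ‖L x‖ ≤ |C| * ‖x‖ := by
    intro x
    refine le_of_sq_le_sq ?_ (by positivity)
    rw [mul_pow, hn, hn, ← tsum_mul_left, sq_abs]
    exact Summable.tsum_le_tsum (hle x) (hs (L x)) ((hs x).mul_left _)
  refine ⟨(b.repr.symm.toContinuousLinearEquiv : _ →L[ℂ] E) ∘L (L.mkContinuous _ hL) ∘L
    (b.repr.toContinuousLinearEquiv : E →L[ℂ] _), fun x i => ?_⟩
  rw [← b.repr_apply_apply, ← b.repr_apply_apply]
  simp [L]

lemma IsDiag.eigenspace_eq {H : E →ₗ.[ℂ] E} {b : HilbertBasis ι ℂ E} {lam : ι → ℂ}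
    (hH : IsDiag H b lam) (z : ℂ) (φ : E) :
    φ ∈ eigenspace H z ↔ ∀ i, lam i ≠ z → inner ℂ (b i) φ = 0 := by
  have h1 : φ ∈ eigenspace H z ↔ ∃ h : φ ∈ H.domain, H ⟨φ, h⟩ = z • φ := by
    unfold eigenspace
    rw [Submodule.mem_map]
    constructor
    · rintro ⟨⟨y, hy⟩, h, rfl⟩
      exact ⟨hy, sub_eq_zero.1 h⟩
    · rintro ⟨h, h'⟩
      exact ⟨⟨φ, h⟩, sub_eq_zero.2 h', rfl⟩
  rw [h1, hH]
  refine forall_congr' fun i => ?_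
  rw [inner_smul_right]
  constructor
  · intro h h'
    have : (lam i - z) * inner ℂ (b i) φ = 0 := by rw [sub_mul, ← h, sub_self]
    exact (mul_eq_zero.1 this).resolve_left (sub_ne_zero.2 h')
  · intro h
    by_cases h' : lam i = z
    · rw [h']
    · rw [h h', mul_zero, mul_zero]

theorem IsDiag.finrank_eigenspace {H : E →ₗ.[ℂ] E} {b : HilbertBasis ι ℂ E} {lam : ι → ℂ}
    (hH : IsDiag H b lam) (z : ℂ) (s : Finset ι) (hs : ∀ i, i ∈ s ↔ lam i = z) :
    Module.finrank ℂ (eigenspace H z) = s.card := by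
  have h : eigenspace H z = Submodule.span ℂ (range fun i : s => b i) := by
    apply le_antisymm
    · intro φ hφ
      rw [hH.eigenspace_eq] at hφ
      have h1 := b.hasSum_repr φ
      have h2 : HasSum (fun i => b.repr φ i • b i) (∑ i ∈ s, b.repr φ i • b i) := by
        refine hasSum_sum_of_ne_finset_zero fun i hi => ?_
        rw [b.repr_apply_apply, hφ i (fun h => hi ((hs i).2 h)), zero_smul]
      rw [h1.unique h2]
      exact Submodule.sum_mem _ fun i hi => Submodule.smul_mem _ _
        (Submodule.subset_span ⟨⟨i, hi⟩, rfl⟩)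
    · refine Submodule.span_le.2 ?_
      rintro _ ⟨⟨j, hj⟩, rfl⟩
      refine (hH.eigenspace_eq z _).2 fun i hi => ?_
      refine b.orthonormal.2 ?_
      rintro rfl
      exact hi ((hs _).1 hj)
  rw [h, finrank_span_eq_card, Fintype.card_coe]
  exact b.orthonormal.linearIndependent.comp _ Subtype.val_injective

/-- Outside a closed set of eigenvalues `|lam i - z|` is bounded below, so multiplication by `(lam i
- z)⁻¹` is bounded and is the resolvent. At `z = lam i` the vector `b i` is annihilated by `H - z`,
which excludes a left inverse. -/
theorem IsDiag.spec_eq {H : E →ₗ.[ℂ] E} {b : HilbertBasis ι ℂ E} {lam : ι → ℂ}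
    (hH : IsDiag H b lam) (hc : IsClosed (range lam)) : spec H = range lam := by
  apply Subset.antisymm
  · intro z hz
    by_contra hz'
    apply hz
    obtain ⟨δ, hδ, hδ'⟩ := Metric.isOpen_iff.1 hc.isOpen_compl z hz'
    have h0 : ∀ i, δ ≤ ‖lam i - z‖ := by
      intro i
      by_contra! h
      exact hδ' (mem_ball_iff_norm.2 h) ⟨i, rfl⟩
    have h0' : ∀ i, lam i - z ≠ 0 := fun i => norm_pos_iff.1 (hδ.trans_le (h0 i))
    obtain ⟨R, hR⟩ := exists_diagonal_clm b (fun i => (lam i - z)⁻¹) (C := δ⁻¹) fun i => by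
      rw [norm_inv]; exact inv_anti₀ hδ (h0 i)
    refine ⟨R, fun χ => ?_, fun φ => ?_⟩
    -- If `R` is the resolvent, `H (R χ)` must be `χ + z R χ`; the coefficient criterion confirms
    -- this and puts `R χ` in the domain.
    · obtain ⟨h, h'⟩ := (hH (R χ) (χ + z • R χ)).2 fun i => by
        rw [inner_add_right, inner_smul_right, hR]
        field_simp [h0' i]
        ring
      exact ⟨h, by rw [h']; abel⟩
    · refine HilbertBasis.ext_inner b fun i => ?_
      rw [hR, inner_sub_right, inner_smul_right, (hH φ (H φ)).1 ⟨φ.2, rfl⟩ i, ← sub_mul,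
        inv_mul_cancel_left₀ (h0' i)]
  · rintro _ ⟨i, rfl⟩ ⟨R, -, hR⟩
    classical
    obtain ⟨h, h'⟩ := (hH (b i) (lam i • b i)).2 fun j => by
      rw [inner_smul_right]
      by_cases hj : j = i
      · rw [hj]
      · rw [b.orthonormal.2 hj, mul_zero, mul_zero]
    have h1 := hR ⟨b i, h⟩
    rw [h', sub_self, map_zero] at h1
    exact b.orthonormal.ne_zero i h1.symm

end Diagonal

variable {N : ℤ} {Λ : AddChar (ℤ × ℤ) Circle}

/-! ### Symmetry of the smooth Hamiltonian -/

lemma volume_restrict_cell : (volume : Measure (ℝ × ℝ)).restrict cell =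
    (volume.restrict (Ioo 0 (2 * Real.pi))).prod (volume.restrict (Ioo 0 (2 * Real.pi))) := by
  rw [cell, Measure.volume_eq_prod, Measure.prod_restrict]

lemma integrableOn_cell {f : ℝ × ℝ → ℂ} (hf : Continuous f) : IntegrableOn f cell := by
  have hK : IsCompact (Icc 0 (2 * Real.pi) ×ˢ Icc 0 (2 * Real.pi) : Set (ℝ × ℝ)) :=
    isCompact_Icc.prod isCompact_Icc
  exact (hf.continuousOn.integrableOn_compact hK).mono_set
    (prod_mono Ioo_subset_Icc_self Ioo_subset_Icc_self)

lemma integral_cell {f : ℝ × ℝ → ℂ} (hf : IntegrableOn f cell) :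
    ∫ p in cell, f p = ∫ x in (0 : ℝ)..2 * Real.pi, ∫ y in (0 : ℝ)..2 * Real.pi, f (x, y) := by
  rw [IntegrableOn, volume_restrict_cell] at hf
  rw [volume_restrict_cell, integral_prod _ hf]
  simp only [intervalIntegral.integral_of_le Real.two_pi_pos.le, integral_Ioc_eq_integral_Ioo]

lemma integral_cell_swap {f : ℝ × ℝ → ℂ} (hf : IntegrableOn f cell) :
    ∫ p in cell, f p = ∫ y in (0 : ℝ)..2 * Real.pi, ∫ x in (0 : ℝ)..2 * Real.pi, f (x, y) := by
  rw [IntegrableOn, volume_restrict_cell] at hf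
  rw [volume_restrict_cell, integral_prod_symm _ hf]
  simp only [intervalIntegral.integral_of_le Real.two_pi_pos.le, integral_Ioc_eq_integral_Ioo]

/-- Integrating in `x` first, the fundamental theorem of calculus leaves only boundary terms, which
cancel by periodicity. -/
lemma integral_cell_fderiv_fst {w : ℝ × ℝ → ℂ} (hw : ContDiff ℝ ∞ w)
    (hp : ∀ m n p, w (shift m n p) = w p) : ∫ p in cell, fderiv ℝ w p (1, 0) = 0 := by
  have hc : Continuous fun p => fderiv ℝ w p (1, 0) :=
    ((hw.fderiv_right (m := ∞) (by simp)).clm_apply contDiff_const).continuous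
  rw [integral_cell_swap (integrableOn_cell hc)]
  have h : ∀ y : ℝ, ∫ x in (0 : ℝ)..2 * Real.pi, fderiv ℝ w (x, y) (1, 0) = 0 := by
    intro y
    have hd : ∀ x : ℝ, HasDerivAt (fun x => w (x, y)) (fderiv ℝ w (x, y) (1, 0)) x := fun x =>
      ((hw.differentiable (by simp) (x, y)).hasFDerivAt).comp_hasDerivAt x
        ((hasDerivAt_id x).prodMk (hasDerivAt_const x y))
    rw [intervalIntegral.integral_eq_sub_of_hasDerivAt (fun x _ => hd x)
      (by apply Continuous.intervalIntegrable; fun_prop)]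
    have := hp 1 0 (0, y)
    simp only [shift] at this
    simp at this
    rw [this, sub_self]
  simp [h]

lemma integral_cell_fderiv_snd {w : ℝ × ℝ → ℂ} (hw : ContDiff ℝ ∞ w)
    (hp : ∀ m n p, w (shift m n p) = w p) : ∫ p in cell, fderiv ℝ w p (0, 1) = 0 := by
  have hc : Continuous fun p => fderiv ℝ w p (0, 1) :=
    ((hw.fderiv_right (m := ∞) (by simp)).clm_apply contDiff_const).continuous
  rw [integral_cell (integrableOn_cell hc)]
  have h : ∀ x : ℝ, ∫ y in (0 : ℝ)..2 * Real.pi, fderiv ℝ w (x, y) (0, 1) = 0 := by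
    intro x
    have hd : ∀ y : ℝ, HasDerivAt (fun y => w (x, y)) (fderiv ℝ w (x, y) (0, 1)) y := fun y =>
      ((hw.differentiable (by simp) (x, y)).hasFDerivAt).comp_hasDerivAt y
        ((hasDerivAt_const y x).prodMk (hasDerivAt_id y))
    rw [intervalIntegral.integral_eq_sub_of_hasDerivAt (fun x _ => hd x)
      (by apply Continuous.intervalIntegrable; fun_prop)]
    have := hp 0 1 (x, 0)
    simp only [shift] at this
    simp at this
    rw [this, sub_self]
  simp [h]

lemma norm_factor (m n : ℤ) (p : ℝ × ℝ) : ‖factor N Λ m n p‖ = 1 := by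
  have : -(Complex.I * m * N * p.2) = ((-(m * N * p.2) : ℝ) : ℂ) * Complex.I := by
    push_cast; ring
  rw [factor, norm_mul, this, Complex.norm_exp_ofReal_mul_I, Circle.norm_coe, one_mul]

/-- The factor of equivariance is unimodular, so it cancels in `conj u * v`. Integration by parts
over the cell therefore has no boundary terms. -/
lemma conj_mul_periodic {u v : ℝ × ℝ → ℂ} {m n : ℤ} {p : ℝ × ℝ}
    (hu : u (shift m n p) = factor N Λ m n p * u p)
    (hv : v (shift m n p) = factor N Λ m n p * v p) :
    conj (u (shift m n p)) * v (shift m n p) = conj (u p) * v p := by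
  have : conj (factor N Λ m n p) * factor N Λ m n p = 1 := by
    rw [Complex.conj_mul', norm_factor]; norm_num
  rw [hu, hv, map_mul, mul_mul_mul_comm, this, one_mul]

lemma contDiff_conj {u : ℝ × ℝ → ℂ} (hu : ContDiff ℝ ∞ u) :
    ContDiff ℝ ∞ fun p => conj (u p) :=
  Complex.conjCLE.contDiff.comp hu

lemma fderiv_conj_mul {u v : ℝ × ℝ → ℂ} (hu : ContDiff ℝ ∞ u) (hv : ContDiff ℝ ∞ v)
    (p a : ℝ × ℝ) : fderiv ℝ (fun p => conj (u p) * v p) p a =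
      conj (fderiv ℝ u p a) * v p + conj (u p) * fderiv ℝ v p a := by
  have h1 := (hu.differentiable (by simp) p).hasFDerivAt
  have h2 := (hv.differentiable (by simp) p).hasFDerivAt
  have h3 : HasFDerivAt (fun p => conj (u p)) _ p :=
    Complex.conjCLE.toContinuousLinearMap.hasFDerivAt.comp p h1
  have h4 : HasFDerivAt (fun p => conj (u p) * v p) _ p := h3.mul h2
  rw [h4.fderiv]
  simp
  ring

lemma integral_covX {u v : ℝ × ℝ → ℂ} (hu : ContDiff ℝ ∞ u) (hv : ContDiff ℝ ∞ v)
    (hu' : ∀ m n p, u (shift m n p) = factor N Λ m n p * u p)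
    (hv' : ∀ m n p, v (shift m n p) = factor N Λ m n p * v p) :
    ∫ p in cell, conj (covX u p) * v p = -∫ p in cell, conj (u p) * covX v p := by
  have h := integral_cell_fderiv_fst ((contDiff_conj hu).mul hv)
    fun m n p => conj_mul_periodic (hu' m n p) (hv' m n p)
  simp only [fderiv_conj_mul hu hv] at h
  rw [integral_add, add_eq_zero_iff_eq_neg] at h
  · exact h
  · exact integrableOn_cell ((contDiff_conj (contDiff_covX hu)).mul hv).continuous
  · exact integrableOn_cell ((contDiff_conj hu).mul (contDiff_covX hv)).continuous

lemma integral_covY {u v : ℝ × ℝ → ℂ} (hu : ContDiff ℝ ∞ u) (hv : ContDiff ℝ ∞ v)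
    (hu' : ∀ m n p, u (shift m n p) = factor N Λ m n p * u p)
    (hv' : ∀ m n p, v (shift m n p) = factor N Λ m n p * v p) :
    ∫ p in cell, conj (covY N u p) * v p = -∫ p in cell, conj (u p) * covY N v p := by
  have h := integral_cell_fderiv_snd ((contDiff_conj hu).mul hv)
    fun m n p => conj_mul_periodic (hu' m n p) (hv' m n p)
  -- The potential term is purely imaginary: its contributions from `conj u` and from `v` cancel, so
  -- the plain derivative may be replaced by the covariant one.
  have h' : ∀ p : ℝ × ℝ, fderiv ℝ (fun p => conj (u p) * v p) p (0, 1) =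
      conj (covY N u p) * v p + conj (u p) * covY N v p := by
    intro p
    have h2 : conj (2 : ℂ) = 2 := Complex.conj_ofNat 2
    rw [fderiv_conj_mul hu hv, covY, covY]
    simp [h2]
    ring
  simp only [h'] at h
  rw [integral_add, add_eq_zero_iff_eq_neg] at h
  · exact h
  · exact integrableOn_cell ((contDiff_conj (contDiff_covY hu)).mul hv).continuous
  · exact integrableOn_cell ((contDiff_conj hu).mul (contDiff_covY hv)).continuous

lemma integral_diffOp {u v : ℝ × ℝ → ℂ} (hu : ContDiff ℝ ∞ u) (hv : ContDiff ℝ ∞ v)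
    (hu' : ∀ m n p, u (shift m n p) = factor N Λ m n p * u p)
    (hv' : ∀ m n p, v (shift m n p) = factor N Λ m n p * v p) :
    ∫ p in cell, conj (diffOp N u p) * v p = ∫ p in cell, conj (u p) * diffOp N v p := by
  have hX := fun m n => covX_equivariant hu (hu' m n)
  have hX' := fun m n => covX_equivariant hv (hv' m n)
  have hY := fun m n => covY_equivariant hu (hu' m n)
  have hY' := fun m n => covY_equivariant hv (hv' m n)
  have e1 : ∀ p, conj (diffOp N u p) * v p =
      -(conj (covX (covX u) p) * v p) - conj (covY N (covY N u) p) * v p := by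
    intro p; simp [diffOp]; ring
  have e2 : ∀ p, conj (u p) * diffOp N v p =
      -(conj (u p) * covX (covX v) p) - conj (u p) * covY N (covY N v) p := by
    intro p; simp [diffOp]; ring
  simp only [e1, e2]
  rw [integral_sub, integral_sub, integral_neg, integral_neg,
    integral_covX (contDiff_covX hu) hv hX hv', integral_covX hu (contDiff_covX hv) hu' hX',
    integral_covY (contDiff_covY hu) hv hY hv', integral_covY hu (contDiff_covY hv) hu' hY',
    neg_neg, neg_neg]
  · exact (integrableOn_cell
      ((contDiff_conj hu).mul (contDiff_covX (contDiff_covX hv))).continuous).neg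
  · exact integrableOn_cell ((contDiff_conj hu).mul (contDiff_covY (contDiff_covY hv))).continuous
  · exact (integrableOn_cell
      ((contDiff_conj (contDiff_covX (contDiff_covX hu))).mul hv).continuous).neg
  · exact integrableOn_cell ((contDiff_conj (contDiff_covY (contDiff_covY hu))).mul hv).continuous

lemma inner_eq_of_ae {φ ψ : HSpace N Λ} {f g : ℝ × ℝ → ℂ} (hf : φ =ᵐ[volume] f)
    (hg : ψ =ᵐ[volume] g) : inner ℂ φ ψ = ∫ p in cell, conj (f p) * g p := by
  rw [inner_eq]
  refine integral_congr_ae ?_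
  filter_upwards [ae_restrict_of_ae hf, ae_restrict_of_ae hg] with p h1 h2
  rw [h1, h2]

lemma coeFn_smoothHamiltonian (φ : (smoothHamiltonian N Λ).domain) {f : ℝ × ℝ → ℂ}
    (hf : ContDiff ℝ ∞ f) (hφ : φ.1 =ᵐ[volume] f) :
    smoothHamiltonian N Λ φ =ᵐ[volume] diffOp N f := by
  have h := rep_eq φ hf.continuous hφ
  subst h
  exact coeFn_ofContinuous _ (contDiff_diffOp hf).continuous
    fun _ _ => diffOp_equivariant hf (rep_equivariant φ _ _)

theorem smoothHamiltonian_symmetric (φ ψ : (smoothHamiltonian N Λ).domain) :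
    inner ℂ (smoothHamiltonian N Λ φ) (ψ : HSpace N Λ) =
      inner ℂ (φ : HSpace N Λ) (smoothHamiltonian N Λ ψ) := by
  rw [inner_eq_of_ae (coeFn_smoothHamiltonian φ (contDiff_rep φ) (ae_eq_rep φ)) (ae_eq_rep ψ),
    inner_eq_of_ae (ae_eq_rep φ) (coeFn_smoothHamiltonian ψ (contDiff_rep ψ) (ae_eq_rep ψ)),
    integral_diffOp (contDiff_rep φ) (contDiff_rep ψ) (rep_equivariant φ) (rep_equivariant ψ)]

/-! ### Gaussian bounds -/

/-- The strength `|N| / 2π` of the magnetic field. -/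
def field (N : ℤ) : ℝ := |(N : ℝ)| / (2 * Real.pi)

lemma field_pos (hN : N ≠ 0) : 0 < field N := by
  have : (N : ℝ) ≠ 0 := Int.cast_ne_zero.2 hN
  unfold field; positivity

/-- The ground state of the harmonic oscillator of frequency `|N| / 2π`. -/
def gauss (N : ℤ) (x : ℝ) : ℝ := Real.exp (-(field N / 2 * x ^ 2))

lemma gauss_pos (x : ℝ) : 0 < gauss N x := Real.exp_pos _

lemma continuous_gauss : Continuous (gauss N) := by unfold gauss; fun_prop

/-- Completing the square. Using `c + 1` instead of `c` keeps a spare factor `exp(-|x|)`, which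
serves summation over `j` and integrability in `x`. -/
lemma gauss_mul_exp_le (hN : N ≠ 0) (c x : ℝ) :
    gauss N x * Real.exp (c * |x|) ≤
      Real.exp ((c + 1) ^ 2 / (2 * field N)) * Real.exp (-|x|) := by
  have hβ := field_pos hN
  rw [gauss, ← Real.exp_add, ← Real.exp_add, Real.exp_le_exp]
  have h : 0 ≤ (field N * |x| - (c + 1)) ^ 2 / (2 * field N) := by positivity
  have h2 : (field N * |x| - (c + 1)) ^ 2 / (2 * field N) =
      field N / 2 * x ^ 2 - (c + 1) * |x| + (c + 1) ^ 2 / (2 * field N) := by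
    rw [← sq_abs x]
    field_simp
    ring
  linarith

lemma exists_norm_eval_mul_gauss_le (hN : N ≠ 0) (p : Polynomial ℂ) :
    ∃ C, 0 ≤ C ∧ ∀ x : ℝ, ‖p.eval (x : ℂ)‖ * gauss N x ≤ C * Real.exp (-|x|) := by
  induction p using Polynomial.induction_on' with
  | add p q hp hq =>
    obtain ⟨C, hC, h1⟩ := hp
    obtain ⟨D, hD, h2⟩ := hq
    refine ⟨C + D, by positivity, fun x => ?_⟩
    rw [Polynomial.eval_add]
    have := norm_add_le (p.eval (x : ℂ)) (q.eval (x : ℂ))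
    nlinarith [h1 x, h2 x, gauss_pos (N := N) x]
  | monomial n a =>
    refine ⟨‖a‖ * (n.factorial * Real.exp ((1 + 1) ^ 2 / (2 * field N))), by positivity,
      fun x => ?_⟩
    rw [Polynomial.eval_monomial, norm_mul, norm_pow, Complex.norm_real, Real.norm_eq_abs]
    have h1 : |x| ^ n ≤ n.factorial * Real.exp (1 * |x|) := by
      rw [one_mul, mul_comm, ← div_le_iff₀ (by positivity)]
      exact Real.pow_div_factorial_le_exp _ (abs_nonneg x) n
    have h2 := gauss_mul_exp_le hN 1 x
    have h3 := gauss_pos (N := N) x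
    calc ‖a‖ * |x| ^ n * gauss N x
        ≤ ‖a‖ * (n.factorial * Real.exp (1 * |x|)) * gauss N x := by gcongr
      _ = ‖a‖ * n.factorial * (gauss N x * Real.exp (1 * |x|)) := by ring
      _ ≤ ‖a‖ * n.factorial * (Real.exp ((1 + 1) ^ 2 / (2 * field N)) * Real.exp (-|x|)) := by
        gcongr
      _ = _ := by ring

lemma summable_exp_neg_abs_int {c : ℝ} (hc : 0 < c) :
    Summable fun j : ℤ => Real.exp (-(c * |(j : ℝ)|)) := by
  have h : Summable fun n : ℕ => Real.exp (-(c * n)) := by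
    have := Real.summable_exp_nat_mul_iff.2 (neg_lt_zero.2 hc)
    refine this.congr fun n => ?_
    rw [← neg_mul, mul_comm]
  refine Summable.of_nat_of_neg ?_ ?_ <;> simpa using h

/-! ### Theta functions -/

/-- The points at which the Gaussian is evaluated in the theta series. -/
def thetaPt (N r j : ℤ) (x : ℝ) : ℝ := x + 2 * Real.pi * r / N + 2 * Real.pi * j

/-- The general term of the theta series. -/
def thetaTerm (N r : ℤ) (p : Polynomial ℂ) (j : ℤ) (q : ℝ × ℝ) : ℂ :=
  p.eval (thetaPt N r j q.1 : ℂ) * gauss N (thetaPt N r j q.1) *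
    Complex.exp (Complex.I * (r + N * j) * q.2)

/-- The theta series `∑ⱼ p(Xⱼ) exp(-|N| Xⱼ² / 4π) exp(i (r + N j) y)`, where
`Xⱼ = x + 2π (r + N j) / N`. -/
def theta (N r : ℤ) (p : Polynomial ℂ) (q : ℝ × ℝ) : ℂ := ∑' j : ℤ, thetaTerm N r p j q

lemma norm_exp_I_int (r j : ℤ) (y : ℝ) : ‖Complex.exp (Complex.I * (r + N * j) * y)‖ = 1 := by
  have : Complex.I * (r + N * j) * y = (((r + N * j) * y : ℝ) : ℂ) * Complex.I := by
    push_cast; ring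
  rw [this, Complex.norm_exp_ofReal_mul_I]

lemma norm_thetaTerm (r : ℤ) (p : Polynomial ℂ) (j : ℤ) (q : ℝ × ℝ) :
    ‖thetaTerm N r p j q‖ =
      ‖p.eval (thetaPt N r j q.1 : ℂ)‖ * gauss N (thetaPt N r j q.1) := by
  rw [thetaTerm, norm_mul, norm_mul, norm_exp_I_int, mul_one, Complex.norm_real,
    Real.norm_of_nonneg (gauss_pos _).le]

lemma exp_neg_abs_thetaPt_le (r j : ℤ) {x R : ℝ} (hx : |x| ≤ R) :
    Real.exp (-|thetaPt N r j x|) ≤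
      Real.exp (R + |2 * Real.pi * r / N|) * Real.exp (-(2 * Real.pi * |(j : ℝ)|)) := by
  rw [← Real.exp_add, Real.exp_le_exp]
  have h1 : |2 * Real.pi * (j : ℝ)| = 2 * Real.pi * |(j : ℝ)| := by
    rw [abs_mul, abs_of_pos Real.two_pi_pos]
  have h2 : 2 * Real.pi * (j : ℝ) = thetaPt N r j x - x - 2 * Real.pi * r / N := by
    rw [thetaPt]; ring
  have h3 := abs_sub (thetaPt N r j x - x) (2 * Real.pi * r / N)
  have h4 := abs_sub (thetaPt N r j x) x
  rw [← h2, h1] at h3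
  linarith

/-- Locally uniform summable bounds for the theta series. -/
lemma exists_bound_thetaTerm (hN : N ≠ 0) (r : ℤ) (p : Polynomial ℂ) (R : ℝ) :
    ∃ u : ℤ → ℝ, Summable u ∧ ∀ j q, |q.1| ≤ R → ‖thetaTerm N r p j q‖ ≤ u j := by
  obtain ⟨C, hC, h⟩ := exists_norm_eval_mul_gauss_le hN p
  refine ⟨fun j => C * (Real.exp (R + |2 * Real.pi * r / N|) *
    Real.exp (-(2 * Real.pi * |(j : ℝ)|))),
    ((summable_exp_neg_abs_int Real.two_pi_pos).mul_left _).mul_left _, fun j q hq => ?_⟩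
  rw [norm_thetaTerm]
  exact (h _).trans (mul_le_mul_of_nonneg_left (exp_neg_abs_thetaPt_le r j hq) hC)

lemma summable_thetaTerm (hN : N ≠ 0) (r : ℤ) (p : Polynomial ℂ) (q : ℝ × ℝ) :
    Summable fun j => thetaTerm N r p j q := by
  obtain ⟨u, hu, h⟩ := exists_bound_thetaTerm hN r p |q.1|
  exact Summable.of_norm_bounded hu fun j => h j q le_rfl

lemma theta_add (hN : N ≠ 0) (r : ℤ) (p₁ p₂ : Polynomial ℂ) :
    theta N r (p₁ + p₂) = theta N r p₁ + theta N r p₂ := by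
  funext q
  rw [Pi.add_apply, theta, theta, theta,
    ← (summable_thetaTerm hN r p₁ q).tsum_add (summable_thetaTerm hN r p₂ q)]
  refine tsum_congr fun j => ?_
  simp only [thetaTerm, Polynomial.eval_add]
  ring

lemma theta_smul (r : ℤ) (c : ℂ) (p : Polynomial ℂ) :
    theta N r (c • p) = c • theta N r p := by
  funext q
  rw [Pi.smul_apply, smul_eq_mul, theta, theta, ← tsum_mul_left]
  refine tsum_congr fun j => ?_
  simp only [thetaTerm, Polynomial.eval_smul, smul_eq_mul]
  ring

/-- The coordinate `(x, y) ↦ x` as a functional `ℝ² → ℂ`. -/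
def coordX : ℝ × ℝ →L[ℝ] ℂ := Complex.ofRealCLM.comp (ContinuousLinearMap.fst ℝ ℝ ℝ)

/-- The coordinate `(x, y) ↦ y` as a functional `ℝ² → ℂ`. -/
def coordY : ℝ × ℝ →L[ℝ] ℂ := Complex.ofRealCLM.comp (ContinuousLinearMap.snd ℝ ℝ ℝ)

/-- The symbol of `∂ₓ` on theta functions. -/
def raiseX (N : ℤ) (p : Polynomial ℂ) : Polynomial ℂ :=
  Polynomial.derivative p - (field N : ℂ) • (Polynomial.X * p)

/-- `∂_y` multiplies the `j`-th term by `i(r + N j)`, that is by `i(N/2π)(X_j - x)`. The potential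
in `covY` cancels the part with `x` and leaves multiplication by `X_j`. -/
lemma thetaPt_sub (hN : N ≠ 0) (r j : ℤ) (x : ℝ) :
    (r + N * j : ℂ) = N / (2 * Real.pi) * (thetaPt N r j x - x) := by
  have h1 : (N : ℂ) ≠ 0 := Int.cast_ne_zero.2 hN
  have h2 : (Real.pi : ℂ) ≠ 0 := Complex.ofReal_ne_zero.2 Real.pi_ne_zero
  rw [thetaPt]
  push_cast
  field_simp
  ring

/-- The derivative of a theta series, in terms of the values of theta series. -/
def thetaDeriv (N : ℤ) (x : ℝ) (a b c : ℂ) : ℝ × ℝ →L[ℝ] ℂ :=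
  a • coordX + (Complex.I * (N / (2 * Real.pi)) * (b - x * c)) • coordY

lemma hasFDerivAt_eval_comp (p : Polynomial ℂ) {f : ℝ × ℝ → ℂ} {f' : ℝ × ℝ →L[ℝ] ℂ} {q : ℝ × ℝ}
    (hf : HasFDerivAt f f' q) :
    HasFDerivAt (fun q => p.eval (f q)) (p.derivative.eval (f q) • f') q :=
  HasDerivAt.comp_hasFDerivAt (h₂ := fun z => p.eval z) q (p.hasDerivAt (f q)) hf

lemma hasFDerivAt_mul_mul {a b c : ℝ × ℝ → ℂ} {a' b' c' : ℝ × ℝ →L[ℝ] ℂ} {q : ℝ × ℝ}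
    (ha : HasFDerivAt a a' q) (hb : HasFDerivAt b b' q) (hc : HasFDerivAt c c' q) :
    HasFDerivAt (fun q => a q * b q * c q)
      ((b q * c q) • a' + (a q * c q) • b' + (a q * b q) • c') q := by
  refine HasFDerivAt.congr_fderiv (f := fun q => a q * b q * c q) ((ha.mul hb).mul hc) ?_
  apply ContinuousLinearMap.ext
  intro v
  simp
  ring

lemma hasFDerivAt_thetaPt (r j : ℤ) (q : ℝ × ℝ) :
    HasFDerivAt (fun q : ℝ × ℝ => (thetaPt N r j q.1 : ℂ)) coordX q := by
  have hx : HasFDerivAt (fun q : ℝ × ℝ => (q.1 : ℂ)) coordX q := coordX.hasFDerivAt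
  have : (fun q : ℝ × ℝ => (thetaPt N r j q.1 : ℂ)) =
      fun q => (q.1 : ℂ) + ((2 * Real.pi * r / N + 2 * Real.pi * j : ℝ) : ℂ) := by
    funext q; rw [thetaPt]; push_cast; ring
  rw [this]
  exact hx.add_const _

lemma hasFDerivAt_gauss_comp {f : ℝ × ℝ → ℝ} {q : ℝ × ℝ}
    (hf : HasFDerivAt (fun q => (f q : ℂ)) coordX q) :
    HasFDerivAt (fun q => (gauss N (f q) : ℂ)) ((-(field N * f q * gauss N (f q)) : ℂ) • coordX)
      q := by
  have hg' : ∀ x : ℝ, (gauss N x : ℂ) = Complex.exp (-((field N : ℂ) / 2 * (x : ℂ) ^ 2)) := by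
    intro x; rw [gauss]; push_cast; rfl
  simp only [hg']
  have hg := (((hf.pow 2).const_mul ((field N : ℂ) / 2)).neg).cexp
  refine HasFDerivAt.congr_fderiv
    (f := fun q => Complex.exp (-((field N : ℂ) / 2 * (f q : ℂ) ^ 2))) hg ?_
  apply ContinuousLinearMap.ext
  intro v
  simp
  ring

lemma hasFDerivAt_exp_coordY (c : ℂ) (q : ℝ × ℝ) :
    HasFDerivAt (fun q : ℝ × ℝ => Complex.exp (c * q.2)) ((c * Complex.exp (c * q.2)) • coordY)
      q := by
  have hy : HasFDerivAt (fun q : ℝ × ℝ => (q.2 : ℂ)) coordY q := coordY.hasFDerivAt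
  refine HasFDerivAt.congr_fderiv (f := fun q : ℝ × ℝ => Complex.exp (c * q.2))
    (hy.const_mul c).cexp ?_
  rw [smul_smul, mul_comm]

/-- Terms of theta series are closed under differentiation, up to a coefficient linear in `x`. One
family of bounds therefore controls all derivatives. -/
lemma hasFDerivAt_thetaTerm (hN : N ≠ 0) (r : ℤ) (p : Polynomial ℂ) (j : ℤ) (q : ℝ × ℝ) :
    HasFDerivAt (thetaTerm N r p j) (thetaDeriv N q.1 (thetaTerm N r (raiseX N p) j q)
      (thetaTerm N r (Polynomial.X * p) j q) (thetaTerm N r p j q)) q := by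
  have hX := hasFDerivAt_thetaPt (N := N) r j q
  have hall := hasFDerivAt_mul_mul (hasFDerivAt_eval_comp p hX) (hasFDerivAt_gauss_comp (N := N) hX)
    (hasFDerivAt_exp_coordY (Complex.I * (r + N * j)) q)
  refine HasFDerivAt.congr_fderiv (f := thetaTerm N r p j) hall ?_
  have hk := thetaPt_sub hN r j q.1
  simp only [thetaDeriv, thetaTerm, raiseX, Polynomial.eval_sub, Polynomial.eval_smul,
    Polynomial.eval_mul, Polynomial.eval_X, smul_eq_mul]
  apply ContinuousLinearMap.ext
  intro v
  change _ * (_ * coordX v) + _ * (_ * coordX v) + _ * (_ * coordY v) =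
    _ * coordX v + _ * coordY v
  generalize Complex.exp (Complex.I * (r + N * j) * q.2) = e
  rw [hk]
  ring

lemma norm_thetaDeriv_le (x : ℝ) (a b c : ℂ) : ‖thetaDeriv N x a b c‖ ≤
    ‖a‖ + ‖Complex.I * (N / (2 * Real.pi) : ℂ)‖ * (‖b‖ + |x| * ‖c‖) := by
  have h1 : ‖coordX‖ ≤ 1 := ContinuousLinearMap.opNorm_le_bound _ zero_le_one fun v => by
    simpa [coordX] using norm_fst_le v
  have h2 : ‖coordY‖ ≤ 1 := ContinuousLinearMap.opNorm_le_bound _ zero_le_one fun v => by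
    simpa [coordY] using norm_snd_le v
  refine (norm_add_le _ _).trans ?_
  rw [norm_smul, norm_smul, norm_mul _ (b - _)]
  have h3 : ‖b - x * c‖ ≤ ‖b‖ + |x| * ‖c‖ := by
    refine (norm_sub_le _ _).trans ?_
    rw [norm_mul, Complex.norm_real, Real.norm_eq_abs]
  exact add_le_add (mul_le_of_le_one_right (norm_nonneg _) h1)
    ((mul_le_of_le_one_right (by positivity) h2).trans
      (mul_le_mul_of_nonneg_left h3 (norm_nonneg _)))

lemma hasFDerivAt_theta (hN : N ≠ 0) (r : ℤ) (p : Polynomial ℂ) (q : ℝ × ℝ) :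
    HasFDerivAt (theta N r p) (thetaDeriv N q.1 (theta N r (raiseX N p) q)
      (theta N r (Polynomial.X * p) q) (theta N r p q)) q := by
  -- The unit ball around `q` stays in `|x| ≤ R`, where the bounds on the terms are uniform; `y`
  -- needs no control, since it enters only through a phase.
  set R := |q.1| + 1 with hR
  obtain ⟨u, hu, hu'⟩ := exists_bound_thetaTerm hN r (raiseX N p) R
  obtain ⟨v, hv, hv'⟩ := exists_bound_thetaTerm hN r (Polynomial.X * p) R
  obtain ⟨w, hw, hw'⟩ := exists_bound_thetaTerm hN r p R
  set K := ‖Complex.I * (N / (2 * Real.pi) : ℂ)‖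
  have hb : Summable fun j => u j + K * (v j + R * w j) :=
    hu.add ((hv.add (hw.mul_left R)).mul_left K)
  have hq : q ∈ Metric.ball q 1 := Metric.mem_ball_self one_pos
  have hball : ∀ q' ∈ Metric.ball q 1, |q'.1| ≤ R := by
    intro q' h
    have h1 : |q'.1 - q.1| ≤ 1 :=
      (norm_fst_le (q' - q)).trans (mem_ball_iff_norm.1 h).le
    have h2 := abs_add_le (q'.1 - q.1) q.1
    rw [sub_add_cancel] at h2
    linarith
  have h := hasFDerivAt_tsum_of_isPreconnected hb Metric.isOpen_ball
    (convex_ball q 1).isPreconnected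
    (fun j q' _ => hasFDerivAt_thetaTerm hN r p j q') (fun j q' h => ?_) hq
    (summable_thetaTerm hN r p q) hq
  · refine HasFDerivAt.congr_fderiv (f := theta N r p) h ?_
    have h1 := (summable_thetaTerm hN r (raiseX N p) q).hasSum
    have h2 := (summable_thetaTerm hN r (Polynomial.X * p) q).hasSum
    have h3 := (summable_thetaTerm hN r p q).hasSum
    exact ((h1.smul_const coordX).add
      (((h2.sub (h3.mul_left _)).mul_left _).smul_const coordY)).tsum_eq
  · refine (norm_thetaDeriv_le _ _ _ _).trans ?_
    have h0 := hball q' h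
    have := hu' j q' h0
    have := hv' j q' h0
    have := hw' j q' h0
    gcongr

/-- The derivative is built from other theta series with smooth coefficients, so the order of
differentiability is raised by induction for all polynomials simultaneously. -/
lemma contDiff_theta (hN : N ≠ 0) (r : ℤ) (p : Polynomial ℂ) : ContDiff ℝ ∞ (theta N r p) := by
  rw [contDiff_infty]
  intro n
  induction n generalizing p with
  | zero =>
    exact contDiff_zero.2 (continuous_iff_continuousAt.2 fun q =>
      (hasFDerivAt_theta hN r p q).continuousAt)
  | succ n ih =>
    push_cast
    rw [contDiff_succ_iff_fderiv]
    refine ⟨fun q => (hasFDerivAt_theta hN r p q).differentiableAt, by simp, ?_⟩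
    have : fderiv ℝ (theta N r p) = fun q => thetaDeriv N q.1 (theta N r (raiseX N p) q)
      (theta N r (Polynomial.X * p) q) (theta N r p q) :=
      funext fun q => (hasFDerivAt_theta hN r p q).fderiv
    rw [this]
    have hx : ContDiff ℝ n fun q : ℝ × ℝ => (q.1 : ℂ) := coordX.contDiff
    exact ((ih _).smul contDiff_const).add
      ((contDiff_const.mul ((ih _).sub (hx.mul (ih p)))).smul contDiff_const)

lemma covX_theta (hN : N ≠ 0) (r : ℤ) (p : Polynomial ℂ) :
    covX (theta N r p) = theta N r (raiseX N p) := by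
  funext q
  rw [covX, (hasFDerivAt_theta hN r p q).fderiv]
  simp [thetaDeriv, coordX, coordY]

lemma covY_theta (hN : N ≠ 0) (r : ℤ) (p : Polynomial ℂ) :
    covY N (theta N r p) = (Complex.I * (N / (2 * Real.pi))) • theta N r (Polynomial.X * p) := by
  funext q
  rw [covY, (hasFDerivAt_theta hN r p q).fderiv]
  simp [thetaDeriv, coordX, coordY]
  ring

/-- The harmonic oscillator, conjugated by its ground state. -/
def oscillator (N : ℤ) (p : Polynomial ℂ) : Polynomial ℂ :=
  -Polynomial.derivative (Polynomial.derivative p) +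
    (2 * field N : ℂ) • (Polynomial.X * Polynomial.derivative p) + (field N : ℂ) • p

/-- On `p(X) exp(-βX²/2)`, `covX` acts as `p ↦ p' - βXp` and `covY` as multiplication by `i(N/2π)X`,
whose square is `-β²X²`. Together they give the harmonic oscillator, and the terms in `X²` cancel
after conjugation by the Gaussian. -/
lemma diffOp_theta (hN : N ≠ 0) (r : ℤ) (p : Polynomial ℂ) :
    diffOp N (theta N r p) = theta N r (oscillator N p) := by
  have hB : (Complex.I * (N / (2 * Real.pi))) * (Complex.I * (N / (2 * Real.pi))) =
      -(field N : ℂ) ^ 2 := by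
    have : ((field N : ℂ)) ^ 2 = (N / (2 * Real.pi)) ^ 2 := by
      have h : field N ^ 2 = (N / (2 * Real.pi)) ^ 2 := by rw [field, div_pow, div_pow, sq_abs]
      have h' := congrArg (fun t : ℝ => (t : ℂ)) h
      push_cast at h'
      exact h'
    rw [this, mul_mul_mul_comm, Complex.I_mul_I]
    ring
  have hp : oscillator N p = (-1 : ℂ) • raiseX N (raiseX N p) +
      ((field N : ℂ) ^ 2) • (Polynomial.X * (Polynomial.X * p)) := by
    simp only [oscillator, raiseX, Polynomial.derivative_sub, Polynomial.derivative_C,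
      Polynomial.derivative_mul, Polynomial.derivative_X, Polynomial.smul_eq_C_mul, map_mul,
      map_neg, map_one, map_pow, Polynomial.C_ofNat]
    ring
  funext q
  rw [diffOp, covX_theta hN, covX_theta hN, covY_theta hN, covY_smul _ (contDiff_theta hN _ _),
    covY_theta hN, smul_smul, hB, hp, theta_add hN, theta_smul, theta_smul]
  simp

/-- Shifting `x` by `2πm` is the reindexing `j ↦ j + m`, and the resulting change of frequency by `N
m` is the factor `exp(-imNy)`. The shift in `y` is invisible because all frequencies are integers.
-/
lemma theta_shift (r : ℤ) (p : Polynomial ℂ) (m n : ℤ) (q : ℝ × ℝ) :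
    theta N r p (shift m n q) = factor N 1 m n q * theta N r p q := by
  rw [theta, theta, ← tsum_mul_left, ← (Equiv.addRight m).tsum_eq (fun j => _ * _)]
  refine tsum_congr fun j => ?_
  have h1 : thetaPt N r j (shift m n q).1 = thetaPt N r (j + m) q.1 := by
    simp only [thetaPt, shift]; push_cast; ring
  have h2 : Complex.exp (Complex.I * (r + N * j) * ((shift m n q).2 : ℝ)) =
      Complex.exp (-(Complex.I * m * N * q.2)) *
        Complex.exp (Complex.I * (r + N * (j + m : ℤ)) * q.2) := by
    rw [← Complex.exp_add, Complex.exp_eq_exp_iff_exists_int]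
    refine ⟨(r + N * j) * n, ?_⟩
    simp only [shift]
    push_cast
    ring
  simp only [thetaTerm, h1, h2, factor, Equiv.coe_addRight, AddChar.one_apply, Circle.coe_one]
  ring

/-- All frequencies in the series are congruent to `r` mod `N`, so translation by `2π/N` multiplies
every term by the same root of unity. This eigenvalue separates the residues. -/
lemma theta_translate (hN : N ≠ 0) (r : ℤ) (p : Polynomial ℂ) (x y : ℝ) :
    theta N r p (x, y + 2 * Real.pi / N) =
      Complex.exp (2 * Real.pi * Complex.I * (r / N)) * theta N r p (x, y) := by
  have h1 : (N : ℂ) ≠ 0 := Int.cast_ne_zero.2 hN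
  rw [theta, theta, ← tsum_mul_left]
  refine tsum_congr fun j => ?_
  have h2 : Complex.exp (Complex.I * (r + N * j) * ((y + 2 * Real.pi / N : ℝ) : ℂ)) =
      Complex.exp (2 * Real.pi * Complex.I * (r / N)) *
        Complex.exp (Complex.I * (r + N * j) * y) := by
    rw [← Complex.exp_add, Complex.exp_eq_exp_iff_exists_int]
    refine ⟨j, ?_⟩
    push_cast
    field_simp
    ring
  simp only [thetaTerm, h2]
  ring

lemma theta_add_mul (hN : N ≠ 0) (r m : ℤ) (p : Polynomial ℂ) :
    theta N (r + N * m) p = theta N r p := by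
  have h1 : (N : ℝ) ≠ 0 := Int.cast_ne_zero.2 hN
  funext q
  rw [theta, theta, ← (Equiv.addRight m).tsum_eq (fun j => thetaTerm N r p j q)]
  refine tsum_congr fun j => ?_
  have h2 : thetaPt N (r + N * m) j q.1 = thetaPt N r (j + m) q.1 := by
    simp only [thetaPt]; push_cast; field_simp; ring
  simp only [thetaTerm, h2, Equiv.coe_addRight]
  push_cast
  ring_nf

lemma integral_exp_int (k : ℤ) : ∫ y in (0 : ℝ)..2 * Real.pi, Complex.exp (Complex.I * k * y) =
    if k = 0 then 2 * Real.pi else 0 := by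
  split_ifs with h
  · simp [h]
  · have hk : Complex.I * k ≠ 0 := mul_ne_zero Complex.I_ne_zero (Int.cast_ne_zero.2 h)
    rw [integral_exp_mul_complex hk]
    have : Complex.exp (Complex.I * k * (2 * Real.pi : ℝ)) = 1 :=
      Complex.exp_eq_one_iff.2 ⟨k, by push_cast; ring⟩
    rw [this]
    simp

lemma continuous_thetaTerm (hN : N ≠ 0) (r : ℤ) (p : Polynomial ℂ) (j : ℤ) :
    Continuous (thetaTerm N r p j) :=
  continuous_iff_continuousAt.2 fun q => (hasFDerivAt_thetaTerm hN r p j q).continuousAt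

/-- The Fourier coefficient of frequency `r` isolates the term `j = 0`; the series may be integrated
termwise by dominated convergence. -/
lemma integral_theta (hN : N ≠ 0) (r : ℤ) (p : Polynomial ℂ) (x : ℝ) :
    ∫ y in (0 : ℝ)..2 * Real.pi, Complex.exp (-(Complex.I * r * y)) * theta N r p (x, y) =
      2 * Real.pi * (p.eval (thetaPt N r 0 x : ℂ) * gauss N (thetaPt N r 0 x)) := by
  obtain ⟨u, hu, hu'⟩ := exists_bound_thetaTerm hN r p |x|
  have hexp : ∀ y : ℝ, ‖Complex.exp (-(Complex.I * r * y))‖ = 1 := by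
    intro y
    have : -(Complex.I * r * y) = ((-(r * y) : ℝ) : ℂ) * Complex.I := by push_cast; ring
    rw [this, Complex.norm_exp_ofReal_mul_I]
  have hs := intervalIntegral.hasSum_integral_of_dominated_convergence (a := 0)
    (b := 2 * Real.pi) (μ := volume)
    (F := fun (j : ℤ) (y : ℝ) => Complex.exp (-(Complex.I * r * y)) * thetaTerm N r p j (x, y))
    (f := fun y => Complex.exp (-(Complex.I * r * y)) * theta N r p (x, y))
    (fun j _ => u j) (fun j => by
      have := continuous_thetaTerm hN r p j
      apply Continuous.aestronglyMeasurable
      fun_prop)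
    (fun j => ae_of_all _ fun y _ => by
      rw [norm_mul, hexp, one_mul]; exact hu' j (x, y) le_rfl)
    (ae_of_all _ fun _ _ => hu) (by simp)
    (ae_of_all _ fun y _ => (summable_thetaTerm hN r p (x, y)).hasSum.mul_left _)
  have hj : ∀ j : ℤ, ∫ y in (0 : ℝ)..2 * Real.pi,
      Complex.exp (-(Complex.I * r * y)) * thetaTerm N r p j (x, y) =
      if j = 0 then 2 * Real.pi * (p.eval (thetaPt N r 0 x : ℂ) * gauss N (thetaPt N r 0 x))
        else 0 := by
    intro j
    have h1 : ∀ y : ℝ, Complex.exp (-(Complex.I * r * y)) * thetaTerm N r p j (x, y) =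
        (p.eval (thetaPt N r j x : ℂ) * gauss N (thetaPt N r j x)) *
          Complex.exp (Complex.I * (N * j : ℤ) * y) := by
      intro y
      rw [thetaTerm, mul_left_comm, ← Complex.exp_add]
      push_cast
      ring_nf
    simp only [h1]
    rw [intervalIntegral.integral_const_mul, integral_exp_int]
    by_cases h : j = 0
    · simp [h]; ring
    · simp [h, hN]
  simp only [hj] at hs
  exact hs.unique (hasSum_ite_eq 0 _)

/-- If the series vanished, so would its Fourier coefficient; as the Gaussian has no zeros, `p`
would vanish at infinitely many points. -/
lemma theta_ne_zero (hN : N ≠ 0) (r : ℤ) {p : Polynomial ℂ} (hp : p ≠ 0) : theta N r p ≠ 0 := by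
  intro h
  apply hp
  refine Polynomial.eq_zero_of_infinite_isRoot p
    (Set.Infinite.mono (s := range fun x : ℝ => (thetaPt N r 0 x : ℂ)) ?_ ?_)
  swap
  · refine infinite_range_of_injective fun x y hxy => ?_
    have h := Complex.ofReal_injective hxy
    simpa [thetaPt] using h
  · rintro _ ⟨x, rfl⟩
    have h1 := integral_theta hN r p x
    simp only [h, Pi.zero_apply, mul_zero, intervalIntegral.integral_zero] at h1
    have h2 : (2 * Real.pi : ℂ) ≠ 0 := by exact_mod_cast Real.two_pi_pos.ne'
    have h3 : (gauss N (thetaPt N r 0 x) : ℂ) ≠ 0 :=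
      Complex.ofReal_ne_zero.2 (gauss_pos _).ne'
    exact (mul_eq_zero.1 ((mul_eq_zero.1 h1.symm).resolve_left h2)).resolve_right h3

/-- Theta functions with different residues are orthogonal. -/
lemma integral_theta_mul_theta (hN : N ≠ 0) {r s : ℤ} (hrs : ¬ N ∣ s - r) (p₁ p₂ : Polynomial ℂ) :
    ∫ q in cell, conj (theta N r p₁ q) * theta N s p₂ q = 0 := by
  set h : ℝ × ℝ → ℂ := fun q => conj (theta N r p₁ q) * theta N s p₂ q with hh
  have hc : Continuous h := ((contDiff_conj (contDiff_theta hN r p₁)).mul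
    (contDiff_theta hN s p₂)).continuous
  set ζ : ℂ := Complex.exp (2 * Real.pi * Complex.I * ((s - r : ℤ) / N)) with hζ
  have hN' : (N : ℂ) ≠ 0 := Int.cast_ne_zero.2 hN
  have h1 : ∀ x y, h (x, y + 2 * Real.pi / N) = ζ * h (x, y) := by
    intro x y
    have : ζ = conj (Complex.exp (2 * Real.pi * Complex.I * (r / N))) *
        Complex.exp (2 * Real.pi * Complex.I * (s / N)) := by
      rw [← Complex.exp_conj, ← Complex.exp_add, hζ]
      congr 1
      have h2 : conj (2 : ℂ) = 2 := Complex.conj_ofNat 2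
      simp [h2]
      ring
    simp only [hh, theta_translate hN, this, map_mul]
    ring
  have h2 : ∀ x, Function.Periodic (fun y => h (x, y)) (2 * Real.pi) := by
    intro x y
    have := conj_mul_periodic (N := N) (Λ := 1) (theta_shift r p₁ 0 1 (x, y))
      (theta_shift s p₂ 0 1 (x, y))
    simpa [shift] using this
  -- Translation by `2π/N` leaves the integral over a period unchanged and multiplies the integrand
  -- by `ζ`. Since `ζ ≠ 1`, the integral vanishes.
  have h3 : ∀ x,
      ∫ y in (0 : ℝ)..2 * Real.pi, h (x, y) = ζ * ∫ y in (0 : ℝ)..2 * Real.pi, h (x, y) := by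
    intro x
    rw [← intervalIntegral.integral_const_mul]
    simp only [← h1]
    rw [intervalIntegral.integral_comp_add_right (fun y => h (x, y)), zero_add,
      add_comm (2 * Real.pi)]
    have := (h2 x).intervalIntegral_add_eq 0 (2 * Real.pi / N)
    rwa [zero_add] at this
  have hζ1 : ζ ≠ 1 := by
    intro h
    obtain ⟨n, hn⟩ := Complex.exp_eq_one_iff.1 h
    apply hrs
    refine ⟨n, ?_⟩
    have h2 : (2 * Real.pi * Complex.I : ℂ) ≠ 0 := Complex.two_pi_I_ne_zero
    rw [mul_comm (n : ℂ)] at hn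
    have := mul_left_cancel₀ h2 hn
    rw [div_eq_iff hN'] at this
    rw [mul_comm]
    exact_mod_cast this
  rw [integral_cell (integrableOn_cell hc)]
  have h4 : ∀ x, ∫ y in (0 : ℝ)..2 * Real.pi, h (x, y) = 0 := by
    intro x
    have := h3 x
    have h5 : (1 - ζ) * ∫ y in (0 : ℝ)..2 * Real.pi, h (x, y) = 0 := by
      rw [sub_mul, one_mul, ← this, sub_self]
    exact (mul_eq_zero.1 h5).resolve_left (sub_ne_zero.2 hζ1.symm)
  simp [h4]

/-! ### Hermite polynomials -/

/-- The eigenpolynomials of the oscillator. -/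
def hermitePoly (N : ℤ) : ℕ → Polynomial ℂ
  | 0 => 1
  | l + 1 => (2 * field N : ℂ) • (Polynomial.X * hermitePoly N l) -
      Polynomial.derivative (hermitePoly N l)

/-- The recursion applies the creation operator `2βX - d/dX`, which raises the eigenvalue of the
oscillator by `2β`. -/
lemma oscillator_hermitePoly (l : ℕ) : oscillator N (hermitePoly N l) =
    (field N * (2 * l + 1) : ℂ) • hermitePoly N l := by
  induction l with
  | zero => simp [oscillator, hermitePoly]
  | succ l ih =>
    have h := congrArg Polynomial.derivative ih
    simp only [oscillator, hermitePoly, Polynomial.derivative_sub,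
      Polynomial.derivative_neg, Polynomial.derivative_ofNat, Polynomial.derivative_natCast,
      Polynomial.derivative_mul, Polynomial.derivative_X, Polynomial.smul_eq_C_mul, map_mul,
      map_one, map_add, map_natCast, Nat.cast_succ, Polynomial.C_ofNat, Polynomial.derivative_C,
      Polynomial.derivative_one, Polynomial.derivative_zero] at h ih ⊢
    -- The creation operator applied to the induction hypothesis: `2βX` times it, minus its
    -- derivative.
    linear_combination (2 * Polynomial.C (field N : ℂ) * Polynomial.X) * ih - h

lemma degree_hermitePoly (hN : N ≠ 0) (l : ℕ) : (hermitePoly N l).degree = l := by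
  have hβ : (2 * field N : ℂ) ≠ 0 := by exact_mod_cast (mul_pos two_pos (field_pos hN)).ne'
  induction l with
  | zero => simp [hermitePoly]
  | succ l ih =>
    have h1 : ((2 * field N : ℂ) • (Polynomial.X * hermitePoly N l)).degree =
        ((l + 1 : ℕ) : WithBot ℕ) := by
      rw [Polynomial.smul_eq_C_mul, Polynomial.degree_C_mul hβ, Polynomial.degree_mul,
        Polynomial.degree_X, ih, add_comm]
      rfl
    rw [hermitePoly, Polynomial.degree_sub_eq_left_of_degree_lt, h1]
    rw [h1]
    refine (Polynomial.degree_derivative_le).trans_lt ?_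
    rw [ih]
    exact_mod_cast Nat.lt_succ_self l

/-- One polynomial in each degree. Orthogonality to the Landau functions thus extends to theta
series of arbitrary polynomials. -/
lemma span_hermitePoly (hN : N ≠ 0) :
    Submodule.span ℂ (range (hermitePoly N)) = ⊤ := by
  let S : Polynomial.Sequence ℂ := ⟨hermitePoly N, degree_hermitePoly hN⟩
  exact S.span fun i => isUnit_iff_ne_zero.2 (Polynomial.leadingCoeff_ne_zero.2 (S.ne_zero i))

/-! ### Injectivity of the Fourier transform on `L¹(ℝ)` -/

/-- Every test function `g` is the Fourier transform of a Schwartz function `F`. Moving the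
transform onto `w` gives `∫ g w = ∫ F ŵ = 0`. -/
lemma ae_eq_zero_of_integral_exp_mul_eq_zero {w : ℝ → ℂ} (hw : Integrable w)
    (h : ∀ t : ℝ, ∫ x : ℝ, Complex.exp (Complex.I * t * x) * w x = 0) : ∀ᵐ x, w x = 0 := by
  refine ae_eq_zero_of_integral_contDiff_smul_eq_zero hw.locallyIntegrable fun g hg hg' => ?_
  have hg₁ : HasCompactSupport (Complex.ofRealCLM ∘ g) := hg'.comp_left rfl
  have hg₂ : ContDiff ℝ ∞ (Complex.ofRealCLM ∘ g) := by fun_prop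
  set G : SchwartzMap ℝ ℂ := hg₁.toSchwartzMap hg₂
  set F : SchwartzMap ℝ ℂ := FourierTransformInv.fourierInv G with hF
  have hFG : ∀ x, FourierTransform.fourier (F : ℝ → ℂ) x = (g x : ℂ) := by
    intro x
    rw [← SchwartzMap.fourier_coe, hF, FourierTransform.fourier_fourierInv_eq]
    rfl
  have hfw : ∀ t, VectorFourier.fourierIntegral Real.fourierChar volume
      (innerₗ ℝ).flip w t = 0 := by
    intro t
    have h1 : VectorFourier.fourierIntegral Real.fourierChar volume (innerₗ ℝ).flip w t =
        FourierTransform.fourier w t := by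
      rw [flip_innerₗ]; rfl
    rw [h1, Real.fourier_real_eq_integral_exp_smul, ← h (-2 * Real.pi * t)]
    refine integral_congr_ae (ae_of_all _ fun x => ?_)
    simp only [smul_eq_mul]
    congr 2
    push_cast
    ring
  have key := VectorFourier.integral_fourierIntegral_smul_eq_flip (L := innerₗ ℝ) (μ := volume)
    (ν := volume) Real.continuous_fourierChar continuous_inner F.integrable hw
  simp only [hfw, smul_zero, integral_zero] at key
  rw [← key]
  refine integral_congr_ae (ae_of_all _ fun x => ?_)
  change _ = FourierTransform.fourier (F : ℝ → ℂ) x • w x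
  rw [hFG]
  simp

/-! ### Unfolding the cell to a strip -/

/-- The strip `ℝ × (0, 2π)`. -/
def strip : Set (ℝ × ℝ) := univ ×ˢ Ioo 0 (2 * Real.pi)

lemma volume_restrict_strip : (volume : Measure (ℝ × ℝ)).restrict strip =
    (volume : Measure ℝ).prod (volume.restrict (Ioo 0 (2 * Real.pi))) := by
  rw [strip, Measure.volume_eq_prod, ← Measure.prod_restrict, Measure.restrict_univ]

/-- Half-open translates of the cell in the `x` direction tile the strip; they differ from
translates of the open cell by null sets. -/
lemma hasSum_integral_strip {h : ℝ × ℝ → ℂ}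
    (hi : ∀ j : ℤ, IntegrableOn (fun q => h (shift j 0 q)) cell)
    (hs : Summable fun j : ℤ => ∫ q in cell, ‖h (shift j 0 q)‖) :
    IntegrableOn h strip ∧
      HasSum (fun j : ℤ => ∫ q in cell, h (shift j 0 q)) (∫ q in strip, h q) := by
  set tile : ℤ → Set (ℝ × ℝ) := fun j =>
    Ioc (0 + j • (2 * Real.pi)) (0 + (j + 1) • (2 * Real.pi)) ×ˢ Ioo 0 (2 * Real.pi) with htile
  have hU : ⋃ j, tile j = strip := by
    rw [htile, strip, ← iUnion_prod_const, iUnion_Ioc_add_zsmul Real.two_pi_pos]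
  have hm : ∀ j, MeasurableSet (tile j) := fun j => measurableSet_Ioc.prod measurableSet_Ioo
  have hd : Pairwise (Function.onFun Disjoint tile) := fun i j hij =>
    Set.disjoint_prod.2 (Or.inl (pairwise_disjoint_Ioc_add_zsmul 0 (2 * Real.pi) hij))
  have hpre : ∀ j : ℤ, (volume : Measure (ℝ × ℝ)).restrict (shift j 0 ⁻¹' tile j) =
      volume.restrict cell := by
    intro j
    have : shift j 0 ⁻¹' tile j = Ioc 0 (2 * Real.pi) ×ˢ Ioo 0 (2 * Real.pi) := by
      ext q
      simp only [htile, shift, mem_preimage, mem_prod, mem_Ioc, mem_Ioo, zsmul_eq_mul]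
      push_cast
      constructor <;> rintro ⟨⟨h1, h2⟩, h3, h4⟩ <;> refine ⟨⟨?_, ?_⟩, ?_, ?_⟩ <;> linarith
    rw [this]
    exact Measure.restrict_congr_set (Measure.set_prod_ae_eq Ioo_ae_eq_Ioc.symm ae_eq_rfl)
  have hemb : ∀ j : ℤ, MeasurableEmbedding (shift j 0) := fun j =>
    measurableEmbedding_addRight ((2 * Real.pi * j, 2 * Real.pi * (0 : ℤ)) : ℝ × ℝ)
  have hint : ∀ j, IntegrableOn h (tile j) := by
    intro j
    rw [← (measurePreserving_shift j 0).integrableOn_comp_preimage (hemb j), IntegrableOn, hpre]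
    exact hi j
  have hnorm : ∀ j, ∫ q in tile j, ‖h q‖ = ∫ q in cell, ‖h (shift j 0 q)‖ := by
    intro j
    rw [← (measurePreserving_shift j 0).setIntegral_preimage_emb (hemb j) (fun q => ‖h q‖), hpre]
  have hval : ∀ j, ∫ q in tile j, h q = ∫ q in cell, h (shift j 0 q) := by
    intro j
    rw [← (measurePreserving_shift j 0).setIntegral_preimage_emb (hemb j) h, hpre]
  have hI : IntegrableOn h (⋃ j, tile j) :=
    integrableOn_iUnion_of_summable_integral_norm hint (by simpa only [hnorm] using hs)
  have := hasSum_integral_iUnion hm hd hI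
  rw [hU] at hI this
  simp only [hval] at this
  exact ⟨hI, this⟩

lemma exp_neg_abs_add_le (j : ℤ) {x : ℝ} (hx : x ∈ Ioo 0 (2 * Real.pi)) :
    Real.exp (-|x + 2 * Real.pi * j|) ≤
      Real.exp (2 * Real.pi) * Real.exp (-(2 * Real.pi * |(j : ℝ)|)) := by
  rw [← Real.exp_add, Real.exp_le_exp]
  have h1 : |2 * Real.pi * (j : ℝ)| = 2 * Real.pi * |(j : ℝ)| := by
    rw [abs_mul, abs_of_pos Real.two_pi_pos]
  have h2 := abs_sub (x + 2 * Real.pi * j) x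
  rw [add_sub_cancel_left, h1, abs_of_pos hx.1] at h2
  linarith [hx.2]

/-- Unfolding for functions with the quasi-periodicity of the complex conjugates of the elements
of `ℋ¹`. -/
lemma unfold_strip {v : ℝ × ℝ → ℂ} (hv : IntegrableOn v cell)
    (hv' : ∀ j : ℤ, ∀ᵐ q : ℝ × ℝ, v (shift j 0 q) = Complex.exp (Complex.I * j * N * q.2) * v q)
    {F : ℝ → ℂ} (hF : Measurable F) {C : ℝ} (hFC : ∀ x, ‖F x‖ ≤ C * Real.exp (-|x|)) (r : ℤ) :
    IntegrableOn (fun q => F q.1 * Complex.exp (Complex.I * r * q.2) * v q) strip ∧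
    ∫ q in strip, F q.1 * Complex.exp (Complex.I * r * q.2) * v q =
      ∫ q in cell, (∑' j : ℤ, F (q.1 + 2 * Real.pi * j) *
        Complex.exp (Complex.I * (r + N * j) * q.2)) * v q := by
  have hC : 0 ≤ C := by
    have := (norm_nonneg _).trans (hFC 0)
    exact nonneg_of_mul_nonneg_left this (Real.exp_pos _)
  set h : ℝ × ℝ → ℂ := fun q => F q.1 * Complex.exp (Complex.I * r * q.2) * v q with hh
  -- The pullback of `h` to the `j`-th tile: the quasi-periodicity of `v` turns the frequency `r`
  -- into `r + N j`, producing the `j`-th term of a theta series.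
  set T : ℤ → ℝ × ℝ → ℂ := fun j q => F (q.1 + 2 * Real.pi * j) *
        Complex.exp (Complex.I * (r + N * j) * q.2) * v q with hT
  have hTh : ∀ j : ℤ, (fun q => h (shift j 0 q)) =ᵐ[volume.restrict cell] T j := by
    intro j
    filter_upwards [ae_restrict_of_ae (hv' j)] with q hq
    simp only [hh, hT, hq]
    rw [← mul_assoc, mul_assoc (F _), ← Complex.exp_add]
    simp only [shift]
    push_cast
    ring_nf
  have hcm : MeasurableSet cell := measurableSet_Ioo.prod measurableSet_Ioo
  have hTb : ∀ j : ℤ, ∀ᵐ q ∂(volume.restrict cell), ‖T j q‖ ≤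
      (C * (Real.exp (2 * Real.pi) * Real.exp (-(2 * Real.pi * |(j : ℝ)|)))) * ‖v q‖ := by
    intro j
    filter_upwards [ae_restrict_mem hcm] with q hq
    rw [hT, norm_mul, norm_mul, norm_exp_I_int, mul_one]
    have := (hFC (q.1 + 2 * Real.pi * j)).trans
      (mul_le_mul_of_nonneg_left (exp_neg_abs_add_le j hq.1) hC)
    gcongr
  have hTi : ∀ j, Integrable (T j) (volume.restrict cell) := by
    intro j
    refine Integrable.mono' (hv.norm.const_mul _) ?_ (hTb j)
    refine AEStronglyMeasurable.mul ?_ hv.1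
    apply Measurable.aestronglyMeasurable
    fun_prop
  have hTs : Summable fun j => ∫ q in cell, ‖T j q‖ := by
    refine Summable.of_nonneg_of_le (fun j => integral_nonneg fun _ => norm_nonneg _) (fun j =>
      integral_mono_ae (hTi j).norm (hv.norm.const_mul _) (hTb j)) ?_
    simp only [integral_const_mul]
    exact (((summable_exp_neg_abs_int Real.two_pi_pos).mul_left _).mul_left _).mul_right _
  obtain ⟨h1, h2⟩ := hasSum_integral_strip (h := h) (fun j => (hTi j).congr (hTh j).symm)
    (hTs.congr fun j => integral_congr_ae ((hTh j).symm.fun_comp norm))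
  refine ⟨h1, ?_⟩
  have h3 := hasSum_integral_of_summable_integral_norm hTi hTs
  have h4 : ∀ j : ℤ, ∫ q in cell, h (shift j 0 q) = ∫ q in cell, T j q := fun j =>
    integral_congr_ae (hTh j)
  simp only [h4] at h2
  rw [h2.unique h3]
  simp only [hT, tsum_mul_right]

/-! ### Completeness of the theta functions -/

/-- Unfolding turns orthogonality to all `theta N r p` into vanishing integrals against `p(X)
exp(-βX²/2) exp(iry)` on the strip. The exponential series of `exp(itX)` is then integrated
termwise, dominated by `exp(|t||X|)` times the Gaussian. -/
lemma integral_strip_eq_zero (hN : N ≠ 0) {v : ℝ × ℝ → ℂ} (hv : IntegrableOn v cell)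
    (hv' : ∀ j : ℤ, ∀ᵐ q : ℝ × ℝ, v (shift j 0 q) = Complex.exp (Complex.I * j * N * q.2) * v q)
    (r : ℤ) (h : ∀ p, ∫ q in cell, theta N r p q * v q = 0) (t : ℝ) :
    IntegrableOn (fun q => Complex.exp (Complex.I * t * thetaPt N r 0 q.1) *
      gauss N (thetaPt N r 0 q.1) * Complex.exp (Complex.I * r * q.2) * v q) strip ∧
    ∫ q in strip, Complex.exp (Complex.I * t * thetaPt N r 0 q.1) * gauss N (thetaPt N r 0 q.1) *
      Complex.exp (Complex.I * r * q.2) * v q = 0 := by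
  set X : ℝ → ℝ := thetaPt N r 0 with hX
  have hXm : Measurable X := by rw [hX]; unfold thetaPt; fun_prop
  have hgm : Measurable (gauss N) := continuous_gauss.measurable
  have hXb : ∀ x, Real.exp (-|X x|) ≤ Real.exp |2 * Real.pi * r / N| * Real.exp (-|x|) := by
    intro x
    rw [← Real.exp_add, Real.exp_le_exp]
    have h1 := abs_sub (X x) (2 * Real.pi * r / N)
    have h2 : X x - 2 * Real.pi * r / N = x := by simp [hX, thetaPt]
    rw [h2] at h1
    linarith
  have hpoly : ∀ p : Polynomial ℂ, ∫ q in strip, (p.eval (X q.1 : ℂ) * gauss N (X q.1)) *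
      Complex.exp (Complex.I * r * q.2) * v q = 0 := by
    intro p
    obtain ⟨C, hC, hp⟩ := exists_norm_eval_mul_gauss_le hN p
    have := (unfold_strip hv hv' (F := fun x => p.eval (X x : ℂ) * gauss N (X x))
      (C := C * Real.exp |2 * Real.pi * r / N|) (by
        have : Measurable fun z : ℂ => p.eval z := p.continuous.measurable
        fun_prop) (fun x => by
        rw [norm_mul, Complex.norm_real, Real.norm_of_nonneg (gauss_pos _).le, mul_assoc]
        exact (hp _).trans (mul_le_mul_of_nonneg_left (hXb x) hC)) r).2
    rw [this, ← h p]
    refine integral_congr_ae (ae_of_all _ fun q => ?_)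
    simp only [theta]
    congr 1
    refine tsum_congr fun j => ?_
    have : X (q.1 + 2 * Real.pi * j) = thetaPt N r j q.1 := by
      simp [hX, thetaPt]; ring
    rw [this, thetaTerm]
  -- The first factor comes from `gauss_mul_exp_le` with `c = |t|`, the second from the offset
  -- between `X x` and `x`.
  set D : ℝ := Real.exp ((|t| + 1) ^ 2 / (2 * field N)) * Real.exp |2 * Real.pi * r / N|
  have hbound : ∀ x, Real.exp (|t| * |X x|) * gauss N (X x) ≤ D * Real.exp (-|x|) := by
    intro x
    rw [mul_comm]
    refine (gauss_mul_exp_le hN |t| (X x)).trans ?_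
    rw [mul_assoc (Real.exp _)]
    exact mul_le_mul_of_nonneg_left (hXb x) (Real.exp_pos _).le
  have hDi : IntegrableOn (fun q => Real.exp (|t| * |X q.1|) * gauss N (X q.1) * ‖v q‖) strip := by
    have := (unfold_strip hv hv'
      (F := fun x => ((Real.exp (|t| * |X x|) * gauss N (X x) : ℝ) : ℂ))
      (C := D) (by fun_prop) (fun x => by
        rw [Complex.norm_real, Real.norm_of_nonneg (mul_pos (Real.exp_pos _) (gauss_pos _)).le]
        exact hbound x) 0).1.norm
    refine this.congr (ae_of_all _ fun q => ?_)
    simp only [norm_mul, Complex.norm_real, Real.norm_of_nonneg (gauss_pos _).le,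
      Real.norm_of_nonneg (Real.exp_pos _).le]
    simp
  have hR : ∀ x : ℝ, HasSum (fun n : ℕ => x ^ n / (n.factorial : ℝ)) (Real.exp x) := fun x => by
    rw [Real.exp_eq_exp_ℝ]; exact NormedSpace.expSeries_div_hasSum_exp x
  have hCx : ∀ z : ℂ, HasSum (fun n : ℕ => z ^ n / (n.factorial : ℂ)) (Complex.exp z) := fun z => by
    rw [Complex.exp_eq_exp_ℂ]; exact NormedSpace.expSeries_div_hasSum_exp z
  -- Unfolding gives measurability of `exp(-|x|) v` on the whole strip; multiplication by `exp |x|`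
  -- recovers `v`.
  have hvm : AEStronglyMeasurable v (volume.restrict strip) := by
    have := (unfold_strip hv hv' (F := fun x => (Real.exp (-|x|) : ℂ)) (C := 1) (by fun_prop)
      (fun x => by rw [Complex.norm_real, Real.norm_of_nonneg (Real.exp_pos _).le, one_mul]) 0).1.1
    have h1 : AEStronglyMeasurable (fun q : ℝ × ℝ => (Real.exp |q.1| : ℂ))
        (volume.restrict strip) := by
      apply Measurable.aestronglyMeasurable; fun_prop
    refine (h1.mul this).congr (ae_of_all _ fun q => ?_)
    simp only [Pi.mul_apply, Int.cast_zero, mul_zero, zero_mul, Complex.exp_zero, mul_one]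
    rw [← mul_assoc, ← Complex.ofReal_mul, ← Real.exp_add, add_neg_cancel, Real.exp_zero,
      Complex.ofReal_one, one_mul]
  have hs := hasSum_integral_of_dominated_convergence (μ := volume.restrict strip)
    (F := fun (n : ℕ) (q : ℝ × ℝ) => ((Polynomial.monomial n
      ((Complex.I * t) ^ n / (n.factorial : ℂ))).eval (X q.1 : ℂ) * gauss N (X q.1)) *
      Complex.exp (Complex.I * r * q.2) * v q)
    (f := fun q => Complex.exp (Complex.I * t * X q.1) * gauss N (X q.1) *
      Complex.exp (Complex.I * r * q.2) * v q)
    (fun n q => ((|t| * |X q.1|) ^ n / (n.factorial : ℝ)) * (gauss N (X q.1) * ‖v q‖))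
    (fun n => by
      refine AEStronglyMeasurable.mul ?_ hvm
      apply Measurable.aestronglyMeasurable
      simp only [Polynomial.eval_monomial]
      fun_prop)
    (fun n => ae_of_all _ fun q => by
      have h0 : ‖Complex.exp (Complex.I * r * q.2)‖ = 1 := by
        simpa using norm_exp_I_int (N := 0) r 0 q.2
      rw [norm_mul, norm_mul, h0, mul_one, norm_mul, Polynomial.eval_monomial]
      simp [Real.norm_of_nonneg (gauss_pos _).le, mul_pow]
      exact le_of_eq (by ring))
    (ae_of_all _ fun q => ((hR _).summable).mul_right _)
    (by
      refine hDi.congr (ae_of_all _ fun q => ?_)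
      simp only [tsum_mul_right, (hR _).tsum_eq]
      ring)
    (ae_of_all _ fun q => by
      refine HasSum.mul_right _ (HasSum.mul_right _ (HasSum.mul_right _ ?_))
      have h0 := hCx (Complex.I * t * X q.1)
      simp only [mul_pow _ (X q.1 : ℂ), mul_div_right_comm] at h0
      simpa only [Polynomial.eval_monomial] using h0)
  simp only [hpoly] at hs
  refine ⟨?_, hs.unique hasSum_zero⟩
  refine (unfold_strip hv hv' (F := fun x => Complex.exp (Complex.I * t * X x) * gauss N (X x))
    (C := D) (by fun_prop) (fun x => ?_) r).1
  have h0 : Complex.I * t * X x = ((t * X x : ℝ) : ℂ) * Complex.I := by push_cast; ring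
  rw [norm_mul, h0, Complex.norm_exp_ofReal_mul_I, Complex.norm_real,
    Real.norm_of_nonneg (gauss_pos _).le]
  refine le_trans ?_ (hbound x)
  exact mul_le_mul_of_nonneg_right (Real.one_le_exp (by positivity)) (gauss_pos _).le

/-- The Fourier coefficients along the second variable vanish. -/
lemma ae_fourier_eq_zero (hN : N ≠ 0) {v : ℝ × ℝ → ℂ} (hv : IntegrableOn v cell)
    (hv' : ∀ j : ℤ, ∀ᵐ q : ℝ × ℝ, v (shift j 0 q) = Complex.exp (Complex.I * j * N * q.2) * v q)
    (r : ℤ) (h : ∀ p, ∫ q in cell, theta N r p q * v q = 0) :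
    ∀ᵐ x : ℝ, ∫ y in Ioo 0 (2 * Real.pi), Complex.exp (Complex.I * r * y) * v (x, y) = 0 := by
  set V : ℝ → ℂ := fun x => ∫ y in Ioo 0 (2 * Real.pi), Complex.exp (Complex.I * r * y) * v (x, y)
    with hV
  have hint := fun t => (integral_strip_eq_zero hN hv hv' r h t).1
  have hfub : ∀ t : ℝ, ∫ x : ℝ, Complex.exp (Complex.I * t * thetaPt N r 0 x) *
      gauss N (thetaPt N r 0 x) * V x = 0 := by
    intro t
    have h1 := (integral_strip_eq_zero hN hv hv' r h t).2
    have h2 := hint t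
    rw [IntegrableOn, volume_restrict_strip] at h2
    rw [volume_restrict_strip, integral_prod _ h2] at h1
    rw [← h1]
    refine integral_congr_ae (ae_of_all _ fun x => ?_)
    simp only [hV, mul_assoc, integral_const_mul]
  have hw : Integrable fun x => gauss N (thetaPt N r 0 x) * V x := by
    have h2 := hint 0
    rw [IntegrableOn, volume_restrict_strip] at h2
    refine h2.integral_prod_left.congr (ae_of_all _ fun x => ?_)
    simp [hV, mul_assoc, integral_const_mul]
  -- By Fubini the Fourier transform of the Gaussian times `V` vanishes. The phase below accounts
  -- for the offset `2πr/N` of `thetaPt` from `x`.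
  have hzero := ae_eq_zero_of_integral_exp_mul_eq_zero hw fun t => by
    have h1 := hfub t
    have h2 : ∀ x : ℝ, Complex.exp (Complex.I * t * x) * (gauss N (thetaPt N r 0 x) * V x) =
        Complex.exp (-(Complex.I * t * (2 * Real.pi * r / N))) *
          (Complex.exp (Complex.I * t * thetaPt N r 0 x) * gauss N (thetaPt N r 0 x) * V x) := by
      intro x
      rw [← mul_assoc, ← mul_assoc, ← mul_assoc, ← Complex.exp_add]
      congr 3
      simp only [thetaPt]
      push_cast
      ring_nf
    simp only [h2]
    rw [integral_const_mul, h1, mul_zero]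
  filter_upwards [hzero] with x hx
  exact (mul_eq_zero.1 hx).resolve_left (Complex.ofReal_ne_zero.2 (gauss_pos _).ne')

/-- Parseval on the circle of length `2π`. -/
lemma integral_norm_sq_eq_zero_of_fourier {f : ℝ → ℂ}
    (hf : MemLp f 2 (volume.restrict (Ioo 0 (2 * Real.pi))))
    (h : ∀ r : ℤ, ∫ y in Ioo 0 (2 * Real.pi), Complex.exp (Complex.I * r * y) * f y = 0) :
    ∫ y in Ioo 0 (2 * Real.pi), ‖f y‖ ^ 2 = 0 := by
  rw [restrict_Ioo_eq_restrict_Ioc] at hf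
  have h1 := hasSum_sq_fourierCoeffOn Real.two_pi_pos hf
  have h2 : ∀ n, fourierCoeffOn Real.two_pi_pos f n = 0 := by
    intro n
    rw [fourierCoeffOn_eq_integral, intervalIntegral.integral_of_le Real.two_pi_pos.le,
      integral_Ioc_eq_integral_Ioo]
    refine smul_eq_zero_of_right _ ?_
    rw [← h (-n)]
    refine integral_congr_ae (ae_of_all _ fun y => ?_)
    have hp : (Real.pi : ℂ) ≠ 0 := Complex.ofReal_ne_zero.2 Real.pi_ne_zero
    simp only [fourier_coe_apply, smul_eq_mul]
    congr 2
    push_cast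
    field_simp
    ring
  have h3 := h1.unique ((hasSum_zero (α := ℝ) (β := ℤ)).congr_fun fun n => by simp [h2])
  rw [intervalIntegral.integral_of_le Real.two_pi_pos.le, integral_Ioc_eq_integral_Ioo] at h3
  have hp := Real.two_pi_pos.ne'
  simpa [hp] using h3

/-- The theta functions are total in `ℋ¹`. -/
theorem eq_zero_of_orthogonal_theta (hN : N ≠ 0) (ψ : HSpace N 1)
    (h : ∀ r p, ∫ q in cell, conj (ψ q) * theta N r p q = 0) : ψ = 0 := by
  have hfin : IsFiniteMeasure ((volume : Measure (ℝ × ℝ)).restrict cell) :=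
    ⟨by
      rw [volume_restrict_cell, ← univ_prod_univ, Measure.prod_prod]
      simp [ENNReal.mul_lt_top]⟩
  set v : ℝ × ℝ → ℂ := fun q => conj (ψ q) with hv
  have hvL : MemLp v 2 (volume.restrict cell) := ψ.2.1.star
  have hvi : IntegrableOn v cell := hvL.integrable (by norm_num)
  have hv' : ∀ j : ℤ, ∀ᵐ q : ℝ × ℝ,
      v (shift j 0 q) = Complex.exp (Complex.I * j * N * q.2) * v q := by
    intro j
    filter_upwards [ψ.2.2 j 0] with q hq
    simp only [hv]
    rw [hq, map_mul, factor]
    simp [← Complex.exp_conj]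
  -- Since `ℤ` is countable, for almost every `x` all Fourier coefficients in `y` vanish at once.
  have hF := ae_all_iff.2 fun r : ℤ => ae_fourier_eq_zero hN hvi hv' r fun p => by
    rw [← h r p]
    exact integral_congr_ae (ae_of_all _ fun q => mul_comm _ _)
  have hsec : ∀ᵐ x ∂(volume.restrict (Ioo 0 (2 * Real.pi))),
      MemLp (fun y => v (x, y)) 2 (volume.restrict (Ioo 0 (2 * Real.pi))) := by
    have h1 := hvL.1
    have h2 := hvL.integrable_norm_pow (by norm_num)
    rw [volume_restrict_cell] at h1 h2
    filter_upwards [h1.prodMk_left, h2.prod_right_ae] with x h3 h4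
    exact (memLp_two_iff_integrable_sq_norm h3).2 (by simpa using h4)
  have hnorm : inner ℂ ψ ψ = 0 := by
    rw [inner_eq]
    have h1 : ∀ q, conj (ψ q) * ψ q = ((‖v q‖ ^ 2 : ℝ) : ℂ) := by
      intro q; rw [Complex.conj_mul', hv]; simp
    simp only [h1]
    rw [integral_complex_ofReal, Complex.ofReal_eq_zero]
    have h2 := hvL.integrable_norm_pow (by norm_num)
    rw [volume_restrict_cell] at h2 ⊢
    rw [integral_prod _ (by simpa using h2)]
    refine integral_eq_zero_of_ae ?_
    filter_upwards [hsec, ae_restrict_of_ae hF] with x h3 h4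
    exact integral_norm_sq_eq_zero_of_fourier h3 h4
  exact inner_self_eq_zero.1 hnorm

/-! ### Magnetic translations -/

open scoped ENNReal in
lemma lintegral_add_right_of_periodic {F : ℝ → ℝ≥0∞} (hF : Function.Periodic F (2 * Real.pi))
    (a : ℝ) : ∫⁻ x in Ioo 0 (2 * Real.pi), F (x + a) = ∫⁻ x in Ioo 0 (2 * Real.pi), F x := by
  rw [restrict_Ioo_eq_restrict_Ioc]
  have h1 : ∫⁻ x in Ioc 0 (2 * Real.pi), F (x + a) = ∫⁻ x in Ioc a (a + 2 * Real.pi), F x := by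
    rw [← (measurePreserving_add_right volume a).setLIntegral_comp_preimage_emb
      (measurableEmbedding_addRight a) F]
    congr 2
    ext x
    simp only [mem_preimage, mem_Ioc]
    constructor <;> rintro ⟨h1, h2⟩ <;> constructor <;> linarith
  rw [h1]
  have h2 := isAddFundamentalDomain_Ioc Real.two_pi_pos a volume
  have h3 := isAddFundamentalDomain_Ioc Real.two_pi_pos 0 volume
  rw [zero_add] at h3
  refine h2.setLIntegral_eq h3 F ?_
  rintro ⟨g, hg⟩ x
  obtain ⟨n, rfl⟩ := AddSubgroup.mem_zmultiples_iff.1 hg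
  change F (n • (2 * Real.pi) + x) = F x
  rw [add_comm]
  exact hF.zsmul n x

lemma measurable_base : Measurable base := by
  unfold base
  exact measurable_id.sub (measurable_const.mul
    ((measurable_from_top (f := fun k : ℤ => (k : ℝ))).comp measurable_idx))

lemma enorm_base_ae (φ : HSpace N Λ) :
    ∀ᵐ p : ℝ × ℝ, ‖φ (base p.1, base p.2)‖ₑ = ‖φ p‖ₑ := by
  filter_upwards [ae_all_iff.2 fun m => ae_all_iff.2 fun n => φ.2.2 m n] with p h
  have h1 := h (-idx p.1) (-idx p.2)
  have h2 : shift (-idx p.1) (-idx p.2) p = (base p.1, base p.2) := by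
    simp [shift, base, sub_eq_add_neg]
  rw [h2] at h1
  rw [h1, ← ofReal_norm, ← ofReal_norm, norm_mul, norm_factor, one_mul]

lemma measurePreserving_translate (a b : ℝ) :
    MeasurePreserving (fun p : ℝ × ℝ => (p.1 + a, p.2 + b)) volume volume :=
  measurePreserving_add_right (volume : Measure (ℝ × ℝ)) (a, b)

lemma lintegral_cell_translate (φ : HSpace N Λ) (a b : ℝ) :
    ∫⁻ p in cell, ‖φ (p.1 + a, p.2 + b)‖ₑ ^ (2 : ℝ) = ∫⁻ p in cell, ‖φ p‖ₑ ^ (2 : ℝ) := by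
  -- A version of `|φ|²` that is periodic everywhere, not just almost everywhere, so that
  -- translation invariance applies on each slice after Tonelli.
  set Q : ℝ → ℝ → ENNReal := fun x y => ‖φ (base x, base y)‖ₑ ^ (2 : ℝ) with hQ
  have hQm : Measurable (Function.uncurry Q) := by
    have h1 : Measurable fun p : ℝ × ℝ => (base p.1, base p.2) :=
      (measurable_base.comp measurable_fst).prodMk (measurable_base.comp measurable_snd)
    have h2 : Measurable fun p : ℝ × ℝ => φ p := AEEqFun.stronglyMeasurable φ.1 |>.measurable
    exact (h2.comp h1).enorm.pow_const _
  have hb : Function.Periodic base (2 * Real.pi) := fun x => by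
    have := base_add x 1
    simpa using this
  have hQ1 : ∀ y, Function.Periodic (fun x => Q x y) (2 * Real.pi) := fun y x => by
    simp only [hQ, hb x]
  have hQ2 : ∀ x, Function.Periodic (Q x) (2 * Real.pi) := fun x y => by
    simp only [hQ, hb y]
  have h1 : ∫⁻ p in cell, ‖φ p‖ₑ ^ (2 : ℝ) = ∫⁻ p in cell, Function.uncurry Q p := by
    refine lintegral_congr_ae (ae_restrict_of_ae ?_)
    filter_upwards [enorm_base_ae φ] with p hp
    rw [← hp]; rfl
  have h2 : ∫⁻ p in cell, ‖φ (p.1 + a, p.2 + b)‖ₑ ^ (2 : ℝ) =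
      ∫⁻ p in cell, Function.uncurry Q (p.1 + a, p.2 + b) := by
    refine lintegral_congr_ae (ae_restrict_of_ae ?_)
    filter_upwards [(measurePreserving_translate a b).quasiMeasurePreserving.ae
      (enorm_base_ae φ)] with p hp
    rw [← hp]; rfl
  have hQm' : Measurable fun p : ℝ × ℝ => Function.uncurry Q (p.1 + a, p.2 + b) :=
    hQm.comp (measurePreserving_translate a b).measurable
  rw [h1, h2, volume_restrict_cell, lintegral_prod _ hQm.aemeasurable,
    lintegral_prod _ hQm'.aemeasurable]
  simp only [Function.uncurry]
  simp only [fun x => lintegral_add_right_of_periodic (hQ2 x) b]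
  refine lintegral_add_right_of_periodic (F := fun x => ∫⁻ y in Ioo 0 (2 * Real.pi), Q x y)
    (fun x => ?_) a
  exact lintegral_congr fun y => hQ1 y x

/-- The magnetic translation `f ↦ exp(i (s y + θ)) f(x + a, y + b)`. -/
def magTrans (s θ a b : ℝ) (f : ℝ × ℝ → ℂ) (p : ℝ × ℝ) : ℂ :=
  Complex.exp (Complex.I * (s * p.2 + θ)) * f (p.1 + a, p.2 + b)

lemma norm_magTrans (s θ a b : ℝ) (f : ℝ × ℝ → ℂ) (p : ℝ × ℝ) :
    ‖magTrans s θ a b f p‖ = ‖f (p.1 + a, p.2 + b)‖ := by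
  have : Complex.I * (s * p.2 + θ) = ((s * p.2 + θ : ℝ) : ℂ) * Complex.I := by push_cast; ring
  rw [magTrans, norm_mul, this, Complex.norm_exp_ofReal_mul_I, one_mul]

lemma magTrans_congr_ae (s θ a b : ℝ) {f g : ℝ × ℝ → ℂ} (h : f =ᵐ[volume] g) :
    magTrans s θ a b f =ᵐ[volume] magTrans s θ a b g := by
  filter_upwards [(measurePreserving_translate a b).quasiMeasurePreserving.ae h] with p hp
  rw [magTrans, hp, magTrans]

lemma aestronglyMeasurable_magTrans (s θ a b : ℝ) {f : ℝ × ℝ → ℂ}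
    (hf : AEStronglyMeasurable f volume) : AEStronglyMeasurable (magTrans s θ a b f) volume := by
  refine AEStronglyMeasurable.mul ?_ (hf.comp_quasiMeasurePreserving
    (measurePreserving_translate a b).quasiMeasurePreserving)
  apply Continuous.aestronglyMeasurable
  fun_prop

lemma eLpNorm_magTrans (φ : HSpace N Λ) (s θ a b : ℝ) :
    eLpNorm (magTrans s θ a b φ) 2 (volume.restrict cell) =
      eLpNorm φ 2 (volume.restrict cell) := by
  rw [eLpNorm_eq_lintegral_rpow_enorm_toReal (by norm_num) (by norm_num),
    eLpNorm_eq_lintegral_rpow_enorm_toReal (by norm_num) (by norm_num)]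
  simp only [ENNReal.toReal_ofNat]
  rw [← lintegral_cell_translate φ a b]
  simp only [← ofReal_norm, norm_magTrans]

/-- The compatibility of the characters `Λ₁`, `Λ₂` with a magnetic translation. -/
def Compatible (N : ℤ) (Λ₁ Λ₂ : AddChar (ℤ × ℤ) Circle) (s b : ℝ) : Prop :=
  ∀ m n : ℤ, (Λ₂ (m, n) : ℂ) = Λ₁ (m, n) * Complex.exp (2 * Real.pi * Complex.I * s * n) *
    Complex.exp (-(Complex.I * m * N * b))

lemma Compatible.symm {Λ₁ Λ₂ : AddChar (ℤ × ℤ) Circle} {s b : ℝ} (h : Compatible N Λ₁ Λ₂ s b) :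
    Compatible N Λ₂ Λ₁ (-s) (-b) := by
  intro m n
  rw [h, mul_assoc, mul_assoc, mul_assoc, ← Complex.exp_add, ← Complex.exp_add, ← Complex.exp_add]
  have : 2 * Real.pi * Complex.I * s * n + (-(Complex.I * m * N * b) +
      (2 * Real.pi * Complex.I * (-s : ℝ) * n + -(Complex.I * m * N * (-b : ℝ)))) = 0 := by
    push_cast; ring
  rw [this, Complex.exp_zero, mul_one]

/-- The factor `exp(isy)` gains `exp(2πisn)` under the shift, and displacing `y` by `b` inside
`factor` gains `exp(-imNb)`. `Compatible` says that these make up the change of character. -/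
lemma magTrans_equivariant {Λ₁ Λ₂ : AddChar (ℤ × ℤ) Circle} {s b : ℝ}
    (hc : Compatible N Λ₁ Λ₂ s b) (θ a : ℝ) {f : ℝ × ℝ → ℂ} {m n : ℤ} {p : ℝ × ℝ}
    (h : f (shift m n (p.1 + a, p.2 + b)) = factor N Λ₁ m n (p.1 + a, p.2 + b) *
      f (p.1 + a, p.2 + b)) :
    magTrans s θ a b f (shift m n p) = factor N Λ₂ m n p * magTrans s θ a b f p := by
  have h1 : ((shift m n p).1 + a, (shift m n p).2 + b) = shift m n (p.1 + a, p.2 + b) := by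
    simp only [shift, Prod.mk.injEq]; constructor <;> ring
  have h2 : Complex.exp (Complex.I * (s * ((shift m n p).2 : ℝ) + θ)) =
      Complex.exp (2 * Real.pi * Complex.I * s * n) *
        Complex.exp (Complex.I * (s * p.2 + θ)) := by
    rw [← Complex.exp_add]
    simp only [shift]
    push_cast
    ring_nf
  have h3 : Complex.exp (-(Complex.I * m * N * ((p.2 + b : ℝ) : ℂ))) =
      Complex.exp (-(Complex.I * m * N * b)) * Complex.exp (-(Complex.I * m * N * p.2)) := by
    rw [← Complex.exp_add]
    push_cast
    ring_nf
  rw [magTrans, magTrans, h1, h, h2, factor, factor, hc]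
  dsimp only
  rw [h3]
  ring

/-- Magnetic translations as linear isometries. -/
def magTransIsometry {Λ₁ Λ₂ : AddChar (ℤ × ℤ) Circle} {s b : ℝ}
    (hc : Compatible N Λ₁ Λ₂ s b) (θ a : ℝ) : HSpace N Λ₁ →ₗᵢ[ℂ] HSpace N Λ₂ where
  toFun φ := ⟨AEEqFun.mk (magTrans s θ a b φ)
      (aestronglyMeasurable_magTrans s θ a b φ.1.aestronglyMeasurable), by
    have hm := aestronglyMeasurable_magTrans s θ a b φ.1.aestronglyMeasurable
    have hmk := AEEqFun.coeFn_mk (magTrans s θ a b φ) hm (μ := volume)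
    refine ⟨(memLp_congr_ae (ae_restrict_of_ae hmk)).2 ⟨hm.restrict, ?_⟩, fun m n => ?_⟩
    · rw [eLpNorm_magTrans]
      exact φ.2.1.2
    · filter_upwards [hmk, (measurePreserving_shift m n).quasiMeasurePreserving.ae hmk,
        (measurePreserving_translate a b).quasiMeasurePreserving.ae (φ.2.2 m n)] with p h1 h2 h3
      rw [h1, h2]
      exact magTrans_equivariant hc θ a h3⟩
  map_add' φ ψ := by
    apply HSpace.ext
    refine (AEEqFun.coeFn_mk _ _).trans ?_
    refine EventuallyEq.trans ?_ (HSpace.coeFn_add _ _).symm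
    filter_upwards [magTrans_congr_ae s θ a b (HSpace.coeFn_add φ ψ),
      AEEqFun.coeFn_mk (magTrans s θ a b φ)
        (aestronglyMeasurable_magTrans s θ a b φ.1.aestronglyMeasurable) (μ := volume),
      AEEqFun.coeFn_mk (magTrans s θ a b ψ)
        (aestronglyMeasurable_magTrans s θ a b ψ.1.aestronglyMeasurable) (μ := volume)]
      with p h1 h2 h3
    rw [h1, h2, h3, magTrans, magTrans, magTrans, mul_add]
  map_smul' c φ := by
    apply HSpace.ext
    refine (AEEqFun.coeFn_mk _ _).trans ?_
    refine EventuallyEq.trans ?_ (HSpace.coeFn_smul _ _).symm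
    filter_upwards [magTrans_congr_ae s θ a b (HSpace.coeFn_smul c φ),
      AEEqFun.coeFn_mk (magTrans s θ a b φ)
        (aestronglyMeasurable_magTrans s θ a b φ.1.aestronglyMeasurable) (μ := volume)]
      with p h1 h2
    rw [h1, h2, magTrans, magTrans, RingHom.id_apply]
    ring
  norm_map' φ := by
    change ‖toL2 _‖ = ‖toL2 φ‖
    simp only [toL2, LinearMap.coe_mk, AddHom.coe_mk, Lp.norm_toLp]
    rw [← eLpNorm_magTrans φ s θ a b]
    congr 1
    exact eLpNorm_congr_ae (ae_restrict_of_ae (AEEqFun.coeFn_mk _ _))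

lemma coeFn_magTransIsometry {Λ₁ Λ₂ : AddChar (ℤ × ℤ) Circle} {s b : ℝ}
    (hc : Compatible N Λ₁ Λ₂ s b) (θ a : ℝ) (φ : HSpace N Λ₁) :
    magTransIsometry hc θ a φ =ᵐ[volume] magTrans s θ a b φ :=
  AEEqFun.coeFn_mk _ _

/-- The inverse acquires a constant phase `s b` from the displaced `y`; the parameter `θ` keeps
inverses inside the family. -/
lemma magTrans_magTrans (s θ a b : ℝ) (f : ℝ × ℝ → ℂ) :
    magTrans s θ a b (magTrans (-s) (s * b - θ) (-a) (-b) f) = f := by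
  funext p
  simp only [magTrans]
  rw [← mul_assoc, ← Complex.exp_add]
  have : Complex.I * (s * p.2 + θ) + Complex.I * ((-s : ℝ) * ((p.2 + b : ℝ) : ℂ) +
      ((s * b - θ : ℝ) : ℂ)) = 0 := by
    push_cast; ring
  rw [this]
  simp

/-- Magnetic translations as unitary maps. -/
def magTransEquiv {Λ₁ Λ₂ : AddChar (ℤ × ℤ) Circle} {s b : ℝ}
    (hc : Compatible N Λ₁ Λ₂ s b) (θ a : ℝ) : HSpace N Λ₁ ≃ₗᵢ[ℂ] HSpace N Λ₂ :=
  LinearIsometryEquiv.ofSurjective (magTransIsometry hc θ a) fun ψ => by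
    refine ⟨magTransIsometry hc.symm (s * b - θ) (-a) ψ, ?_⟩
    apply HSpace.ext
    refine (coeFn_magTransIsometry hc θ a _).trans ?_
    refine (magTrans_congr_ae s θ a b (coeFn_magTransIsometry hc.symm _ _ ψ)).trans ?_
    rw [magTrans_magTrans]

lemma coeFn_magTransEquiv {Λ₁ Λ₂ : AddChar (ℤ × ℤ) Circle} {s b : ℝ}
    (hc : Compatible N Λ₁ Λ₂ s b) (θ a : ℝ) (φ : HSpace N Λ₁) :
    magTransEquiv hc θ a φ =ᵐ[volume] magTrans s θ a b φ :=
  AEEqFun.coeFn_mk _ _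

/-! ### Magnetic translations commute with the covariant derivatives -/

lemma hasFDerivAt_magTrans (s θ a b : ℝ) {f : ℝ × ℝ → ℂ} (hf : ContDiff ℝ ∞ f) (p : ℝ × ℝ) :
    HasFDerivAt (magTrans s θ a b f) (Complex.exp (Complex.I * (s * p.2 + θ)) •
      (fderiv ℝ f (p.1 + a, p.2 + b) + (Complex.I * s * f (p.1 + a, p.2 + b)) • coordY)) p := by
  have h1 : HasFDerivAt (fun p : ℝ × ℝ => (p.2 : ℂ)) coordY p := coordY.hasFDerivAt
  have h2 := (((h1.const_mul (s : ℂ)).add_const (θ : ℂ)).const_mul Complex.I).cexp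
  have h3 : HasFDerivAt (fun p : ℝ × ℝ => f (p.1 + a, p.2 + b))
      (fderiv ℝ f (p.1 + a, p.2 + b)) p :=
    HasFDerivAt.comp (f := fun q => q + (a, b)) p
      (hf.differentiable (by simp) (p + (a, b))).hasFDerivAt
      ((hasFDerivAt_id p).add_const (a, b))
  refine HasFDerivAt.congr_fderiv (f := magTrans s θ a b f) (h2.mul h3) ?_
  apply ContinuousLinearMap.ext
  intro v
  simp
  ring

lemma contDiff_magTrans (s θ a b : ℝ) {f : ℝ × ℝ → ℂ} (hf : ContDiff ℝ ∞ f) :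
    ContDiff ℝ ∞ (magTrans s θ a b f) := by
  have h1 : ContDiff ℝ ∞ fun p : ℝ × ℝ => (p.2 : ℂ) := coordY.contDiff
  have h2 : ContDiff ℝ ∞ fun p : ℝ × ℝ => f (p.1 + a, p.2 + b) :=
    hf.comp ((contDiff_fst.add contDiff_const).prodMk (contDiff_snd.add contDiff_const))
  exact ((contDiff_const.mul ((contDiff_const.mul h1).add contDiff_const)).cexp).mul h2

lemma covX_magTrans (s θ a b : ℝ) {f : ℝ × ℝ → ℂ} (hf : ContDiff ℝ ∞ f) :
    covX (magTrans s θ a b f) = magTrans s θ a b (covX f) := by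
  funext p
  rw [covX, (hasFDerivAt_magTrans s θ a b hf p).fderiv]
  simp [magTrans, covX, coordY]

/-- Translating `x` by `a` changes the potential by `iNa/2π`, and differentiating `exp(isy)`
produces `is`. The relation between `s` and `a` makes the two agree. -/
lemma covY_magTrans {s a : ℝ} (hs : s = N * a / (2 * Real.pi)) (θ b : ℝ) {f : ℝ × ℝ → ℂ}
    (hf : ContDiff ℝ ∞ f) :
    covY N (magTrans s θ a b f) = magTrans s θ a b (covY N f) := by
  funext p
  rw [covY, (hasFDerivAt_magTrans s θ a b hf p).fderiv, hs]
  simp [magTrans, covY, coordY]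
  ring

lemma diffOp_magTrans {s a : ℝ} (hs : s = N * a / (2 * Real.pi)) (θ b : ℝ) {f : ℝ × ℝ → ℂ}
    (hf : ContDiff ℝ ∞ f) :
    diffOp N (magTrans s θ a b f) = magTrans s θ a b (diffOp N f) := by
  funext p
  rw [diffOp, covX_magTrans s θ a b hf, covX_magTrans s θ a b (contDiff_covX hf),
    covY_magTrans hs θ b hf, covY_magTrans hs θ b (contDiff_covY hf)]
  simp only [magTrans, diffOp]
  ring

/-- Magnetic translations commute with the smooth Hamiltonian. -/
lemma smoothHamiltonian_magTransEquiv {Λ₁ Λ₂ : AddChar (ℤ × ℤ) Circle} {s a b : ℝ}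
    (hc : Compatible N Λ₁ Λ₂ s b) (hs : s = N * a / (2 * Real.pi)) (θ : ℝ)
    (φ : (smoothHamiltonian N Λ₁).domain) :
    ∃ h : magTransEquiv hc θ a φ ∈ (smoothHamiltonian N Λ₂).domain,
      smoothHamiltonian N Λ₂ ⟨magTransEquiv hc θ a φ, h⟩ =
        magTransEquiv hc θ a (smoothHamiltonian N Λ₁ φ) := by
  have hφ := contDiff_rep φ
  have h1 : magTransEquiv hc θ a φ.1 =ᵐ[volume] magTrans s θ a b (rep φ) :=
    (coeFn_magTransEquiv hc θ a φ.1).trans (magTrans_congr_ae s θ a b (ae_eq_rep φ))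
  have h2 := contDiff_magTrans s θ a b hφ
  refine ⟨⟨_, h2, h1⟩, ?_⟩
  apply HSpace.ext
  refine (coeFn_smoothHamiltonian _ h2 h1).trans ?_
  refine EventuallyEq.trans ?_ (coeFn_magTransEquiv hc θ a _).symm
  rw [diffOp_magTrans hs θ b hφ]
  exact magTrans_congr_ae s θ a b (coeFn_smoothHamiltonian φ hφ (ae_eq_rep φ)).symm

/-! ### The Landau basis -/

/-- The element of `ℋ¹` given by a theta series. -/
def thetaVec (hN : N ≠ 0) (r : ℤ) : Polynomial ℂ →ₗ[ℂ] HSpace N 1 where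
  toFun p := ofContinuous (theta N r p) (contDiff_theta hN r p).continuous (theta_shift r p)
  map_add' p₁ p₂ := by
    apply HSpace.ext
    refine (coeFn_ofContinuous _ _ _).trans (EventuallyEq.trans ?_ (HSpace.coeFn_add _ _).symm)
    rw [theta_add hN]
    exact ((coeFn_ofContinuous _ _ _).add (coeFn_ofContinuous _ _ _)).symm
  map_smul' c p := by
    apply HSpace.ext
    refine (coeFn_ofContinuous _ _ _).trans (EventuallyEq.trans ?_ (HSpace.coeFn_smul _ _).symm)
    rw [theta_smul]
    filter_upwards [coeFn_ofContinuous (theta N r p) (contDiff_theta hN r p).continuous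
      (theta_shift r p)] with q hq
    rw [hq]
    rfl

lemma coeFn_thetaVec (hN : N ≠ 0) (r : ℤ) (p : Polynomial ℂ) :
    thetaVec hN r p =ᵐ[volume] theta N r p :=
  coeFn_ofContinuous _ (contDiff_theta hN r p).continuous (theta_shift r p)

lemma thetaVec_ne_zero (hN : N ≠ 0) (r : ℤ) {p : Polynomial ℂ} (hp : p ≠ 0) :
    thetaVec hN r p ≠ 0 := by
  intro h
  apply theta_ne_zero hN r hp
  have h1 := coeFn_thetaVec hN r p
  rw [h] at h1
  have h2 : theta N r p =ᵐ[volume] (fun _ => 0 : ℝ × ℝ → ℂ) :=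
    h1.symm.trans (AEEqFun.coeFn_zero (α := ℝ × ℝ) (β := ℂ) (μ := volume))
  exact ((contDiff_theta hN r p).continuous.ae_eq_iff_eq volume continuous_const).1 h2

lemma smoothHamiltonian_thetaVec (hN : N ≠ 0) (r : ℤ) (p : Polynomial ℂ) :
    ∃ h : thetaVec hN r p ∈ (smoothHamiltonian N 1).domain,
      smoothHamiltonian N 1 ⟨thetaVec hN r p, h⟩ = thetaVec hN r (oscillator N p) := by
  refine ⟨⟨_, contDiff_theta hN r p, coeFn_thetaVec hN r p⟩, ?_⟩
  apply HSpace.ext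
  refine (coeFn_smoothHamiltonian _ (contDiff_theta hN r p) (coeFn_thetaVec hN r p)).trans ?_
  rw [diffOp_theta hN]
  exact (coeFn_thetaVec hN r _).symm

/-- The Landau levels `|N| / π (l + 1 / 2)`. -/
def landau (N : ℤ) (l : ℕ) : ℝ := |(N : ℝ)| / Real.pi * ((l : ℝ) + 1 / 2)

lemma landau_eq (l : ℕ) : landau N l = field N * (2 * l + 1) := by
  rw [landau, field]
  field_simp

lemma landau_injective (hN : N ≠ 0) : Function.Injective (landau N) := by
  intro l k h
  rw [landau_eq, landau_eq] at h
  have := mul_left_cancel₀ (field_pos hN).ne' h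
  have h2 : (l : ℝ) = k := by linarith
  exact_mod_cast h2

/-- The unnormalized Landau basis. -/
def landauVec (hN : N ≠ 0) (i : ℕ × Fin N.natAbs) : HSpace N 1 :=
  thetaVec hN (i.2 : ℕ) (hermitePoly N i.1)

lemma smoothHamiltonian_landauVec (hN : N ≠ 0) (i : ℕ × Fin N.natAbs) :
    ∃ h : landauVec hN i ∈ (smoothHamiltonian N 1).domain,
      smoothHamiltonian N 1 ⟨landauVec hN i, h⟩ = (landau N i.1 : ℂ) • landauVec hN i := by
  obtain ⟨h, h'⟩ := smoothHamiltonian_thetaVec hN (i.2 : ℕ) (hermitePoly N i.1)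
  refine ⟨h, h'.trans ?_⟩
  rw [oscillator_hermitePoly, map_smul, landau_eq]
  push_cast
  rfl

lemma not_dvd_sub {r s : Fin N.natAbs} (h : r ≠ s) : ¬ N ∣ ((s : ℕ) : ℤ) - (r : ℕ) := by
  intro hd
  apply h
  have h1 : ((s : ℕ) : ℤ) - (r : ℕ) = 0 := by
    refine Int.eq_zero_of_abs_lt_dvd ((Int.natAbs_dvd).2 hd) ?_
    rw [abs_lt]
    have := r.2
    have := s.2
    constructor <;> omega
  ext
  omega

/-- For equal residues the degrees differ, so these are eigenvectors of a symmetric operator with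
distinct eigenvalues. For different residues the translation by `2π/N` in `y` gives orthogonality.
-/
lemma inner_landauVec (hN : N ≠ 0) {i j : ℕ × Fin N.natAbs} (hij : i ≠ j) :
    inner ℂ (landauVec hN i) (landauVec hN j) = 0 := by
  by_cases h : i.2 = j.2
  · obtain ⟨h1, h1'⟩ := smoothHamiltonian_landauVec hN i
    obtain ⟨h2, h2'⟩ := smoothHamiltonian_landauVec hN j
    have h3 := smoothHamiltonian_symmetric ⟨_, h1⟩ ⟨_, h2⟩
    rw [h1', h2', inner_smul_left, inner_smul_right, Complex.conj_ofReal] at h3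
    have h4 : ((landau N i.1 : ℂ) - landau N j.1) *
        inner ℂ (landauVec hN i) (landauVec hN j) = 0 := by
      rw [sub_mul, h3, sub_self]
    refine (mul_eq_zero.1 h4).resolve_left (sub_ne_zero.2 fun h5 => hij ?_)
    exact Prod.ext (landau_injective hN (Complex.ofReal_injective h5)) h
  · rw [landauVec, landauVec, inner_eq_of_ae (coeFn_thetaVec hN _ _) (coeFn_thetaVec hN _ _)]
    exact integral_theta_mul_theta hN (not_dvd_sub h) _ _

lemma landauVec_ne_zero (hN : N ≠ 0) (i : ℕ × Fin N.natAbs) : landauVec hN i ≠ 0 := by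
  refine thetaVec_ne_zero hN _ fun h => ?_
  have := degree_hermitePoly hN i.1
  rw [h, Polynomial.degree_zero] at this
  exact WithBot.bot_ne_coe this

lemma orthonormal_landau (hN : N ≠ 0) :
    Orthonormal ℂ fun i => ((‖landauVec hN i‖⁻¹ : ℝ) : ℂ) • landauVec hN i := by
  constructor
  · intro i
    rw [norm_smul, Complex.norm_real, norm_inv, norm_norm,
      inv_mul_cancel₀ (norm_ne_zero_iff.2 (landauVec_ne_zero hN i))]
  · intro i j hij
    simp only [inner_smul_left, inner_smul_right, inner_landauVec hN hij, mul_zero]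

/-- By linearity the Hermite polynomials may be replaced by all polynomials, and by `theta_add_mul`
the residues `0, …, |N| - 1` account for all integers `r`. -/
lemma eq_zero_of_inner_landauVec (hN : N ≠ 0) {ψ : HSpace N 1}
    (h : ∀ i, inner ℂ ψ (landauVec hN i) = 0) : ψ = 0 := by
  have h1 : ∀ (r : Fin N.natAbs) p, inner ℂ ψ (thetaVec hN (r : ℕ) p) = 0 := by
    intro r p
    have h2 : Submodule.span ℂ (range (hermitePoly N)) ≤
        LinearMap.ker ((innerₛₗ ℂ ψ).comp (thetaVec hN (r : ℕ))) := by
      refine Submodule.span_le.2 ?_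
      rintro _ ⟨l, rfl⟩
      exact h (l, r)
    rw [span_hermitePoly hN] at h2
    exact h2 (Submodule.mem_top (x := p))
  refine eq_zero_of_orthogonal_theta hN ψ fun r p => ?_
  have h3 : 0 ≤ r % N := Int.emod_nonneg r hN
  have h4 : (r % N).toNat < N.natAbs := by
    have := Int.emod_lt_abs r hN
    rw [Int.abs_eq_natAbs] at this
    omega
  have h5 : r = ((r % N).toNat : ℤ) + N * (r / N) := by
    rw [Int.toNat_of_nonneg h3, Int.emod_add_mul_ediv]
  have h6 := h1 ⟨_, h4⟩ p
  rw [inner_eq_of_ae (EventuallyEq.refl _ _) (coeFn_thetaVec hN _ _)] at h6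
  rw [h5, theta_add_mul hN]
  exact h6

/-- The Hilbert basis of `ℋ¹` consisting of eigenfunctions of the Hamiltonian. -/
def landauBasis (hN : N ≠ 0) : HilbertBasis (ℕ × Fin N.natAbs) ℂ (HSpace N 1) :=
  HilbertBasis.mkOfOrthogonalEqBot (orthonormal_landau hN) (by
    rw [Submodule.eq_bot_iff]
    intro ψ hψ
    refine eq_zero_of_inner_landauVec hN fun i => ?_
    have h1 := (Submodule.mem_orthogonal' _ ψ).1 hψ _ (Submodule.subset_span ⟨i, rfl⟩)
    rw [inner_smul_right] at h1
    refine (mul_eq_zero.1 h1).resolve_left ?_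
    exact Complex.ofReal_ne_zero.2 (inv_ne_zero (norm_ne_zero_iff.2 (landauVec_ne_zero hN i))))

lemma smoothHamiltonian_landauBasis (hN : N ≠ 0) (i : ℕ × Fin N.natAbs) :
    ∃ h : landauBasis hN i ∈ (smoothHamiltonian N 1).domain,
      smoothHamiltonian N 1 ⟨landauBasis hN i, h⟩ = (landau N i.1 : ℂ) • landauBasis hN i := by
  obtain ⟨h, h'⟩ := smoothHamiltonian_landauVec hN i
  have h1 : landauBasis hN i = ((‖landauVec hN i‖⁻¹ : ℝ) : ℂ) • landauVec hN i := by
    rw [landauBasis, HilbertBasis.coe_mkOfOrthogonalEqBot]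
  rw [h1]
  refine ⟨Submodule.smul_mem _ _ h, ?_⟩
  have h2 := (smoothHamiltonian N 1).map_smul ((‖landauVec hN i‖⁻¹ : ℝ) : ℂ) ⟨_, h⟩
  rw [h', smul_comm] at h2
  exact h2

lemma isDiag_hamiltonian_one (hN : N ≠ 0) :
    IsDiag (hamiltonian N 1) (landauBasis hN) fun i => (landau N i.1 : ℂ) :=
  isDiag_friedrichs smoothHamiltonian_symmetric (smoothHamiltonian_landauBasis hN)

/-- The transported Landau basis consists of smooth eigenvectors in `ℋ^Λ`, so the criterion applies
there directly; Friedrichs extensions need not be transported. -/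
lemma isDiag_hamiltonian (hN : N ≠ 0) {s a b : ℝ} (hc : Compatible N 1 Λ s b)
    (hs : s = N * a / (2 * Real.pi)) (θ : ℝ) :
    IsDiag (hamiltonian N Λ) (mapBasis (landauBasis hN) (magTransEquiv hc θ a))
      fun i => (landau N i.1 : ℂ) := by
  refine isDiag_friedrichs smoothHamiltonian_symmetric fun i => ?_
  obtain ⟨h, h'⟩ := smoothHamiltonian_landauBasis hN i
  obtain ⟨h1, h1'⟩ := smoothHamiltonian_magTransEquiv hc hs θ ⟨_, h⟩
  rw [mapBasis_apply]
  refine ⟨h1, h1'.trans ?_⟩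
  rw [h', map_smul]

/-! ### Exponents of characters and the assembly of the theorem -/

lemma compatible_of_exponents (hN : N ≠ 0) {μ ν : ℝ} (h : ∀ m n : ℤ, (Λ (m, n) : ℂ) =
    Complex.exp (2 * Real.pi * Complex.I * (μ * m + ν * n))) :
    Compatible N 1 Λ ν (-(2 * Real.pi * μ / N)) := by
  have hN' : (N : ℂ) ≠ 0 := Int.cast_ne_zero.2 hN
  intro m n
  rw [h, AddChar.one_apply, Circle.coe_one, one_mul, ← Complex.exp_add]
  congr 1
  push_cast
  field_simp
  ring

lemma exists_exponents (Λ : AddChar (ℤ × ℤ) Circle) : ∃ μ ν : ℝ, ∀ m n : ℤ, (Λ (m, n) : ℂ) =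
    Complex.exp (2 * Real.pi * Complex.I * (μ * m + ν * n)) := by
  have hp : (Real.pi : ℂ) ≠ 0 := Complex.ofReal_ne_zero.2 Real.pi_ne_zero
  -- A character is determined by its values at the two generators; their arguments give the
  -- exponents, not normalized to `[0, 1)`.
  refine ⟨Complex.arg (Λ (1, 0)) / (2 * Real.pi), Complex.arg (Λ (0, 1)) / (2 * Real.pi),
    fun m n => ?_⟩
  have h1 : ((m, n) : ℤ × ℤ) = m • (1, 0) + n • (0, 1) := by ext <;> simp
  rw [h1, AddChar.map_add_eq_mul, AddChar.map_zsmul_eq_zpow, AddChar.map_zsmul_eq_zpow]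
  have h2 : ∀ z : Circle, (z : ℂ) = Complex.exp (Complex.arg z * Complex.I) := fun z => by
    rw [← Circle.coe_exp, Circle.exp_arg]
  rw [Circle.coe_mul, Circle.coe_zpow, Circle.coe_zpow, h2 (Λ (1, 0)), h2 (Λ (0, 1)),
    ← Complex.exp_int_mul, ← Complex.exp_int_mul, ← Complex.exp_add]
  simp only [← h2]
  congr 1
  push_cast
  field_simp

lemma exists_compatible (hN : N ≠ 0) (Λ : AddChar (ℤ × ℤ) Circle) :
    ∃ s a b : ℝ, Compatible N 1 Λ s b ∧ s = N * a / (2 * Real.pi) := by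
  obtain ⟨μ, ν, h⟩ := exists_exponents Λ
  have hN' : (N : ℝ) ≠ 0 := Int.cast_ne_zero.2 hN
  refine ⟨ν, 2 * Real.pi * ν / N, _, compatible_of_exponents hN h, ?_⟩
  field_simp

/-- The levels are the image of `ℕ` under a closed embedding; this is the closedness that
`IsDiag.spec_eq` needs. -/
lemma isClosed_range_landau (hN : N ≠ 0) :
    IsClosed (range fun l : ℕ => (landau N l : ℂ)) := by
  have hN' : (N : ℝ) ≠ 0 := Int.cast_ne_zero.2 hN
  have hc : |(N : ℝ)| / Real.pi ≠ 0 := by positivity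
  have h1 : Topology.IsClosedEmbedding fun x : ℝ => |(N : ℝ)| / Real.pi * (x + 1 / 2) :=
    ((Homeomorph.addRight (1 / 2 : ℝ)).trans (Homeomorph.mulLeft₀ _ hc)).isClosedEmbedding
  exact (Complex.isometry_ofReal.isClosedEmbedding.comp
    (h1.comp Nat.isClosedEmbedding_coe_real)).isClosed_range

lemma IsDiag.congr_basis {E ι : Type*} [NormedAddCommGroup E] [InnerProductSpace ℂ E]
    {H : E →ₗ.[ℂ] E} {b b' : HilbertBasis ι ℂ E} {lam : ι → ℂ} (hH : IsDiag H b lam)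
    (h : ∀ i, b i = b' i) : IsDiag H b' lam := by
  intro φ χ
  simpa only [h] using hH φ χ

lemma range_landau_fst (hN : N ≠ 0) : (range fun i : ℕ × Fin N.natAbs => (landau N i.1 : ℂ)) =
    range fun l : ℕ => (landau N l : ℂ) := by
  ext z
  constructor
  · rintro ⟨i, rfl⟩
    exact ⟨i.1, rfl⟩
  · rintro ⟨l, rfl⟩
    exact ⟨(l, ⟨0, Int.natAbs_pos.2 hN⟩), rfl⟩

theorem spec_hamiltonian (hN : N ≠ 0) (Λ : AddChar (ℤ × ℤ) Circle) :
    spec (hamiltonian N Λ) = range fun l : ℕ => (landau N l : ℂ) := by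
  obtain ⟨s, a, b, hc, hs⟩ := exists_compatible hN Λ
  rw [(isDiag_hamiltonian hN hc hs 0).spec_eq, range_landau_fst hN]
  rw [range_landau_fst hN]
  exact isClosed_range_landau hN

theorem finrank_eigenspace_hamiltonian (hN : N ≠ 0) (Λ : AddChar (ℤ × ℤ) Circle) (l : ℕ) :
    Module.finrank ℂ (eigenspace (hamiltonian N Λ) (landau N l : ℂ)) = N.natAbs := by
  obtain ⟨s, a, b, hc, hs⟩ := exists_compatible hN Λ
  rw [(isDiag_hamiltonian hN hc hs 0).finrank_eigenspace _ ({l} ×ˢ Finset.univ)]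
  · simp
  · rintro ⟨k, r⟩
    simp [(landau_injective hN).eq_iff, eq_comm]

theorem exists_unitary_conjugate (hN : N ≠ 0) (Λ₁ Λ₂ : AddChar (ℤ × ℤ) Circle) :
    ∃ U : HSpace N Λ₁ ≃ₗᵢ[ℂ] HSpace N Λ₂,
      hamiltonian N Λ₂ = conjugate U (hamiltonian N Λ₁) := by
  obtain ⟨s₁, a₁, b₁, hc₁, hs₁⟩ := exists_compatible hN Λ₁
  obtain ⟨s₂, a₂, b₂, hc₂, hs₂⟩ := exists_compatible hN Λ₂
  -- Passing through `ℋ¹`, this unitary matches the two transported Landau bases vector by vector.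
  refine ⟨(magTransEquiv hc₁ 0 a₁).symm.trans (magTransEquiv hc₂ 0 a₂), ?_⟩
  refine (isDiag_hamiltonian hN hc₂ hs₂ 0).unique
    (((isDiag_hamiltonian hN hc₁ hs₁ 0).conjugate _).congr_basis fun i => ?_)
  rw [mapBasis_apply, mapBasis_apply, mapBasis_apply]
  simp

theorem exists_translation_conjugate (hN : N ≠ 0) (Λ : AddChar (ℤ × ℤ) Circle) (μ ν : ℝ)
    (h : ∀ m n : ℤ, (Λ (m, n) : ℂ) = Complex.exp (2 * Real.pi * Complex.I * (μ * m + ν * n))) :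
    ∃ T : HSpace N 1 ≃ₗᵢ[ℂ] HSpace N Λ,
      (∀ φ : HSpace N 1, ∀ᵐ p : ℝ × ℝ, T φ p = Complex.exp (Complex.I * ν * p.2) *
        φ (p.1 + 2 * Real.pi * ν / N, p.2 - 2 * Real.pi * μ / N)) ∧
      hamiltonian N Λ = conjugate T (hamiltonian N 1) := by
  have hN' : (N : ℝ) ≠ 0 := Int.cast_ne_zero.2 hN
  have hc := compatible_of_exponents hN h
  have hs : ν = N * (2 * Real.pi * ν / N) / (2 * Real.pi) := by field_simp
  refine ⟨magTransEquiv hc 0 (2 * Real.pi * ν / N), fun φ => ?_,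
    (isDiag_hamiltonian hN hc hs 0).unique ((isDiag_hamiltonian_one hN).conjugate _)⟩
  filter_upwards [coeFn_magTransEquiv hc 0 (2 * Real.pi * ν / N) φ] with p hp
  rw [hp, magTrans, ← sub_eq_add_neg]
  simp [mul_assoc]

end MagneticTorus

end

theorem mainTheorem7 (N : ℤ) (hN : N ≠ 0) :
    (∀ Λ : AddChar (ℤ × ℤ) Circle,
      MagneticTorus.spec (MagneticTorus.hamiltonian N Λ) =
          Set.range (fun l : ℕ => ((|(N : ℝ)| / Real.pi * ((l : ℝ) + 1 / 2) : ℝ) : ℂ)) ∧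
      ∀ l : ℕ, Module.finrank ℂ (MagneticTorus.eigenspace (MagneticTorus.hamiltonian N Λ)
          ((|(N : ℝ)| / Real.pi * ((l : ℝ) + 1 / 2) : ℝ) : ℂ)) = N.natAbs) ∧
    (∀ Λ₁ Λ₂ : AddChar (ℤ × ℤ) Circle,
      ∃ U : MagneticTorus.HSpace N Λ₁ ≃ₗᵢ[ℂ] MagneticTorus.HSpace N Λ₂,
        MagneticTorus.hamiltonian N Λ₂ =
          MagneticTorus.conjugate U (MagneticTorus.hamiltonian N Λ₁)) ∧
    (∀ (Λ : AddChar (ℤ × ℤ) Circle) (μ ν : ℝ), μ ∈ Set.Ico (0 : ℝ) 1 → ν ∈ Set.Ico (0 : ℝ) 1 →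
      (∀ m n : ℤ, (Λ (m, n) : ℂ) = Complex.exp (2 * Real.pi * Complex.I * (μ * m + ν * n))) →
      ∃ T : MagneticTorus.HSpace N 1 ≃ₗᵢ[ℂ] MagneticTorus.HSpace N Λ,
        (∀ φ : MagneticTorus.HSpace N 1, ∀ᵐ p : ℝ × ℝ,
          T φ p = Complex.exp (Complex.I * ν * p.2) *
            φ (p.1 + 2 * Real.pi * ν / N, p.2 - 2 * Real.pi * μ / N)) ∧
        MagneticTorus.hamiltonian N Λ =
          MagneticTorus.conjugate T (MagneticTorus.hamiltonian N 1)) := by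
  exact ⟨fun Λ => ⟨MagneticTorus.spec_hamiltonian hN Λ,
    MagneticTorus.finrank_eigenspace_hamiltonian hN Λ⟩,
    MagneticTorus.exists_unitary_conjugate hN,
    fun Λ μ ν _ _ h => MagneticTorus.exists_translation_conjugate hN Λ μ ν h⟩
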